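/- Let $\mathbf K\in\{\mathbb R,\mathbb C\}$. All spaces are Hausdorff locally convex spaces over $\mathbf K$, and maps may be partially defined. **The class $C^k_\Pi$.** For a partial function $f:A\supseteq\operatorname{dom}f\to B$ let $d_uf(x)=\lim_{t\to0}t^{-1}(f(x+tu)-f(x))$ ($0\ne t\in\mathbf K$, $x+tu\in\operatorname{dom}f$), defined exactly for those $x\in\operatorname{dom}f$ for which $0$ is a limit point of the admissible $t$ and the limit exists, and let $d^lf(x)(u_1,\dots,u_l)=(d_{u_l}\cdots d_{u_1}f)(x)$. For $k\in\{0,1,2,\dots\}\cup\{\infty\}$, $f$ is of class $C^k_\Pi$ if $\Omega=\operatorname{dom}f$ is open and for every integer $0\le l\le k$ and every $x\in\Omega$ the map $d^lf(x)$ is defined on $A^l$, multilinear and continuous, and for every zero neighbourhood $W$ in $B$ there is a zero neighbourhood $U$ in $A$ such that for every $\varepsilon>0$ there is a zero neighbourhood $V$ in $A$ with $x+V\subseteq\Omega$ and $(d^lf(x+v)-d^lf(x))[U^l]\subseteq\varepsilon W$ for all $v\in V$. For $f:A\times C\supseteq\operatorname{dom}f\to B$ let $\partial_2f(x,y)$ be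 the function $v\mapsto d_{(0,v)}f(x,y)$ on $C$, whenever all these derivatives exist. **$B\partial_2$-extensibility.** Let $f$ be a partial function from $E\times F$ to $F$, let $k\in\{1,2,\dots\}\cup\{\infty\}$, $z=(x^0,y^0)\in E\times F$ and $b\in F$ with $f(z)=b$. Then $f$ is *$B\partial_2$-extensible in $C^k_\Pi$ around $(z,b)$* if there are a nonempty directed preordered set $I$, a projective system of Banach(able) spaces $F_i$ $(i\in I)$ with continuous linear connecting maps $\rho_{ij}:F_j\to F_i$ $(i\le j)$ and with projective limit $F$ in the category of Hausdorff locally convex spaces, with projections $\rho_i:F\to F_i$, partial functions $f_i$ from $E\times F_i$ to $F_i$ of class $C^k_\Pi$ with $f_i(x,\rho_iy)=\rho_i(f(x,y))$ for $(x,y)\in\operatorname{dom}f$ and $i\in I$, an index $i_0\in I$ and an open $W_0\subseteq E\times F_{i_0}$ with $(x^0,\rho_{i_0}y^0)\in W_0\subseteq\operatorname{dom}f_{i_0}$, such that (1) $\partial_2f_{i_0}(x^0,\rho_{i_0}y^0):F_{i_0}\to F_{i_0}$ is bijective, and for every $j\ge i_0$: $\rho_{i_0j}$ is injective; $\rho_j\circ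 f=f_j\circ(\mathrm{id}\times\rho_j)$ and $\rho_{i_0j}\circ f_j=f_{i_0}\circ(\mathrm{id}\times\rho_{i_0j})$ as partial functions (including equality of domains); and (2) if $(x,y)\in\operatorname{dom}f_j$, $(x,\rho_{i_0j}y)\in W_0$ and $\partial_2f_{i_0}(x,\rho_{i_0j}y)$ is bijective $F_{i_0}\to F_{i_0}$, then $\partial_2f_j(x,y)$ is bijective $F_j\to F_j$; (3) if $x^1\in E$, $y^1\in F_{i_0}$ with $f_{i_0}(x^1,y^1)=\rho_{i_0}b$, and $y_n\in F_j$ $(n\ge1)$ satisfy $f_{i_0}(n^{-1}x^0+(1-n^{-1})x^1,\rho_{i_0j}y_n)=\rho_{i_0}b$ for all $n\ge1$ and $\rho_{i_0j}y_n\to y^1$ in $F_{i_0}$, then $y^1\in\rho_{i_0j}[F_j]$. **Theorem.** If $f$ is $B\partial_2$-extensible in $C^k_\Pi$ around $(z,b)$, then there is an open set $W\subseteq E\times F$ with $z\in W$ such that $f^{-1}(\{b\})\cap W\subseteq E\times F$ is the graph of a partial function from $E$ to $F$ of class $C^k_\Pi$ (in particular its domain is open in $E$). -/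

import Mathlib

open Filter Topology
open scoped Pointwise

universe uK uE uF uI uG

noncomputable section

namespace KellerIFT

section Calculus

variable (𝕜 : Type*) [RCLike 𝕜]
variable {A B : Type*} [AddCommGroup A] [Module 𝕜 A] [AddCommGroup B] [Module 𝕜 B]
  [TopologicalSpace B]

/-- `y` is the limit of `t⁻¹ (f (x + t u) - f x)` as `t → 0` in `𝕜 \ {0}` with `x + t u ∈ dom f`,
where `x ∈ dom f` and `0` is a limit point of the admissible `t`. -/
def HasDirDeriv (f : A →. B) (u x : A) (y : B) : Prop :=
  ∃ a ∈ f x, (∃ᶠ t in 𝓝[≠] (0 : 𝕜), x + t • u ∈ f.Dom) ∧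
    ∀ N ∈ 𝓝 y, ∀ᶠ t in 𝓝[≠] (0 : 𝕜), ∀ c ∈ f (x + t • u), t⁻¹ • (c - a) ∈ N

/-- The directional derivative `d_u f`, a partial function defined exactly where the limit
exists. The limit is unique as soon as the codomain is Hausdorff. -/
def dirDeriv (f : A →. B) (u : A) : A →. B := fun x =>
  ⟨∃ y, HasDirDeriv 𝕜 f u x y, fun h => h.choose⟩

/-- `d(u₁, …, u_l) f = d_{u_l} (d(u₁, …, u_{l-1}) f)`, and `d(∅) f = f`. -/
def iterDirDeriv (f : A →. B) : (l : ℕ) → (Fin l → A) → (A →. B)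
  | 0, _ => f
  | l + 1, u => dirDeriv 𝕜 (iterDirDeriv f l (Fin.init u)) (u (Fin.last l))

/-- The partial function `f` belongs to Keller's class `C^k_Π`: its domain `Ω` is open, for every
`l ≤ k` the `l`-th differential `D = d^l f` exists on all of `Ω` and has continuous multilinear
maps as values, and it satisfies Keller's continuity condition `(π)`. -/
def IsKellerC [TopologicalSpace A] (k : ℕ∞) (f : A →. B) : Prop :=
  IsOpen f.Dom ∧
  ∀ l : ℕ, (l : ℕ∞) ≤ k →
    ∃ D : A → ContinuousMultilinearMap 𝕜 (fun _ : Fin l => A) B,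
      (∀ x ∈ f.Dom, ∀ u : Fin l → A, D x u ∈ iterDirDeriv 𝕜 f l u x) ∧
      ∀ x ∈ f.Dom, ∀ W ∈ 𝓝 (0 : B), ∃ U ∈ 𝓝 (0 : A), ∀ ε : ℝ, 0 < ε →
        ∃ V ∈ 𝓝 (0 : A), ∀ v ∈ V, x + v ∈ f.Dom ∧
          ∀ u : Fin l → A, (∀ i, u i ∈ U) → D (x + v) u - D x u ∈ (ε : 𝕜) • W

/-- A relation `R ⊆ A × B` is (the graph of) a map of class `C^k_Π`. -/
def RelIsKellerC [TopologicalSpace A] (k : ℕ∞) (R : Set (A × B)) : Prop :=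
  ∃ g : A →. B, g.graph = R ∧ IsKellerC 𝕜 k g

/-- `∂₂ f (z)` is defined and equals the function `ℓ`. -/
def IsPartialDeriv₂ {C : Type*} [AddCommGroup C] [Module 𝕜 C]
    (f : A × C →. B) (z : A × C) (ℓ : C → B) : Prop :=
  ∀ v : C, ℓ v ∈ dirDeriv 𝕜 f ((0 : A), v) z

end Calculus

section ProjectiveLimits

variable (𝕜 : Type uK) [RCLike 𝕜] {ι : Type uI} [Preorder ι]
  {G : ι → Type uG} [∀ i, AddCommGroup (G i)] [∀ i, Module 𝕜 (G i)] [∀ i, TopologicalSpace (G i)]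

/-- `ρ` is a projective system of continuous linear maps over a directed preordered set. -/
structure IsProjectiveSystem (ρ : ∀ i j : ι, i ≤ j → G j →L[𝕜] G i) : Prop where
  directed : ∀ i j : ι, ∃ k, i ≤ k ∧ j ≤ k
  map_self : ∀ (i : ι) (y : G i), ρ i i le_rfl y = y
  map_map : ∀ (i j k : ι) (hij : i ≤ j) (hjk : j ≤ k) (y : G k),
    ρ i j hij (ρ j k hjk y) = ρ i k (hij.trans hjk) y

/-- `p` is a cone over `ρ` with vertex `X`. -/
def IsCone (ρ : ∀ i j : ι, i ≤ j → G j →L[𝕜] G i)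
    {X : Type*} [AddCommGroup X] [Module 𝕜 X] [TopologicalSpace X]
    (p : ∀ i, X →L[𝕜] G i) : Prop :=
  ∀ (i j : ι) (hij : i ≤ j), p i = (ρ i j hij).comp (p j)

/-- `(F, p)` is a projective limit of the system `ρ` in the category of Hausdorff locally convex
spaces over `𝕜`, with nonempty index set. The test spaces `X` range over a universe that contains
all the data. -/
def IsProjectiveLimit (ρ : ∀ i j : ι, i ≤ j → G j →L[𝕜] G i)
    {F : Type uF} [AddCommGroup F] [Module 𝕜 F] [TopologicalSpace F]
    (p : ∀ i, F →L[𝕜] G i) : Prop :=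
  IsProjectiveSystem 𝕜 ρ ∧ Nonempty ι ∧ IsCone 𝕜 ρ p ∧
  ∀ (X : Type (max uK uF uI uG)) [AddCommGroup X] [Module 𝕜 X] [Module ℝ X] [IsScalarTower ℝ 𝕜 X]
    [TopologicalSpace X] [IsTopologicalAddGroup X] [ContinuousSMul 𝕜 X] [LocallyConvexSpace ℝ X]
    [T2Space X] (q : ∀ i, X →L[𝕜] G i), IsCone 𝕜 ρ q →
      ∃! ℓ : X →L[𝕜] F, ∀ i, q i = (p i).comp ℓ

end ProjectiveLimits

section Extensions

variable (𝕜 : Type uK) [RCLike 𝕜]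
  {E : Type uE} [AddCommGroup E] [Module 𝕜 E] [TopologicalSpace E]
  {F : Type uF} [AddCommGroup F] [Module 𝕜 F] [TopologicalSpace F]
  {ι : Type uI} [Preorder ι] {G : ι → Type uG} [∀ i, NormedAddCommGroup (G i)]
  [∀ i, NormedSpace 𝕜 (G i)]

/-- `(G i, φ i, p i)` is a `Bp₂`-extension of `f` by `ρ`. Every `G i` carries a norm that defines
its topology; the choice of the norm plays no role. -/
structure IsBp₂Extension (f : E × F →. F) (ρ : ∀ i j : ι, i ≤ j → G j →L[𝕜] G i)
    (φ : ∀ i, E × G i →. G i) (p : ∀ i, F →L[𝕜] G i) : Prop where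
  isProjectiveLimit : IsProjectiveLimit 𝕜 ρ p
  complete : ∀ i, CompleteSpace (G i)
  extends_map : ∀ (i : ι) (x : E) (y c : F), c ∈ f (x, y) → p i c ∈ φ i (x, p i y)

/-- `(G i, φ i, p i)` is a `B∂₂`-extension of `f` in `C^k_Π` by `ρ` around `(x₀, y₀, b)`.
Equalities in `Part` are equalities of partial functions, including their domains. -/
def IsBd₂Extension (k : ℕ∞) (f : E × F →. F) (x₀ : E) (y₀ b : F)
    (ρ : ∀ i j : ι, i ≤ j → G j →L[𝕜] G i)
    (φ : ∀ i, E × G i →. G i) (p : ∀ i, F →L[𝕜] G i) : Prop :=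
  IsBp₂Extension 𝕜 f ρ φ p ∧ 1 ≤ k ∧ b ∈ f (x₀, y₀) ∧ (∀ i, IsKellerC 𝕜 k (φ i)) ∧
  ∃ (i₀ : ι) (W₀ : Set (E × G i₀)),
    IsOpen W₀ ∧ (x₀, p i₀ y₀) ∈ W₀ ∧ W₀ ⊆ (φ i₀).Dom ∧
    -- condition (1)
    (∃ ℓ : G i₀ → G i₀, IsPartialDeriv₂ 𝕜 (φ i₀) (x₀, p i₀ y₀) ℓ ∧ Function.Bijective ℓ) ∧
    ∀ (j : ι) (hj : i₀ ≤ j),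
      Function.Injective (ρ i₀ j hj) ∧
      (∀ (x : E) (y : F), (f (x, y)).map (p j) = φ j (x, p j y)) ∧
      (∀ (x : E) (y : G j), (φ j (x, y)).map (ρ i₀ j hj) = φ i₀ (x, ρ i₀ j hj y)) ∧
      -- condition (2)
      (∀ (x : E) (y : G j) (ℓ : G j → G j), IsPartialDeriv₂ 𝕜 (φ j) (x, y) ℓ →
        (x, ρ i₀ j hj y) ∈ W₀ →
        (∃ ℓ₀ : G i₀ → G i₀,
          IsPartialDeriv₂ 𝕜 (φ i₀) (x, ρ i₀ j hj y) ℓ₀ ∧ Function.Bijective ℓ₀) →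
        Function.Bijective ℓ) ∧
      -- condition (3)
      (∀ (x₁ : E) (y₁ : G i₀) (y : ℕ → G j),
        (∀ n : ℕ, 1 ≤ n →
          p i₀ b ∈ φ i₀ ((n : 𝕜)⁻¹ • x₀ + (1 - (n : 𝕜)⁻¹) • x₁, ρ i₀ j hj (y n))) →
        p i₀ b ∈ φ i₀ (x₁, y₁) →
        Tendsto (fun n => ρ i₀ j hj (y n)) atTop (𝓝 y₁) →
        y₁ ∈ Set.range (ρ i₀ j hj))

/-- `f` is `B∂₂`-extensible in `C^k_Π` around `(z, b)`. -/
def IsBd₂Extensible (k : ℕ∞) (f : E × F →. F) (z : E × F) (b : F) : Prop :=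
  ∃ (ι : Type uI) (_ : Preorder ι) (G : ι → Type uG) (_ : ∀ i, NormedAddCommGroup (G i))
    (_ : ∀ i, NormedSpace 𝕜 (G i)) (ρ : ∀ i j : ι, i ≤ j → G j →L[𝕜] G i)
    (φ : ∀ i, E × G i →. G i) (p : ∀ i, F →L[𝕜] G i),
    IsBd₂Extension 𝕜 k f z.1 z.2 b ρ φ p

end Extensions

end KellerIFT

end

set_option linter.unusedSectionVars false

namespace KellerIFT

/-! The equation is solved in the single Banach space `G i₀`, and the solution is then lifted to
`F`. At level `i₀` the Banach implicit function theorem with parameter `x`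
(`IsKellerJet.exists_implicit`) gives a continuous solution `g` on a neighbourhood `N` of `x₀`,
star-shaped about `x₀`, that is unique in a ball.

The main difficulty is that an implicit function theorem applied separately at each level `j ≥ i₀`
would give neighbourhoods shrinking with `j`. Since `ρ i₀ j` is injective, a lift of `g x` to `G j`
is unique if it exists. The points of `N` where it exists include `x₀`; they form an open set by the
local theorem at level `j`, applicable because of condition (2) (`exists_continuousAt_lift`); they
are closed along segments from `x₀` by condition (3). Connectedness of segments
(`forall_mem_of_segment`) yields all of `N`, the same for every `j`. The lifts are compatible and
define `gF : N → F`.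

For smoothness, the classical theorem along finite-dimensional affine plots makes each component
`C^k`. The formula of Faà di Bruno, solved for the top derivative by inverting `∂₂`, expresses it
through lower derivatives; induction on the order transfers the uniformity `(π)` from the equation
to the component (`uniformAt_plotDeriv_of_seminorm`). Finally `C^k_Π` can be checked on components,
as a zero neighbourhood of `F` is controlled by a single `G j` (`isKellerC_of_forall_component`). -/

theorem hasDirDeriv_of_mem_dirDeriv {𝕜 : Type*} [RCLike 𝕜] {A : Type*} [AddCommGroup A]
    [Module 𝕜 A] {B : Type*} [AddCommGroup B] [Module 𝕜 B] [TopologicalSpace B] {f : A →. B} {u x : A} {y : B}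
    (h : y ∈ dirDeriv 𝕜 f u x) : HasDirDeriv 𝕜 f u x y := by
  obtain ⟨h, rfl⟩ := h
  exact h.choose_spec

/-! ### Directional derivatives of partial functions on open sets. -/

section DirectionalDerivatives

variable {𝕜 : Type*} [RCLike 𝕜] {A : Type*} [AddCommGroup A] [Module 𝕜 A] [TopologicalSpace A]
  [IsTopologicalAddGroup A] [ContinuousSMul 𝕜 A]
  {B : Type*} [AddCommGroup B] [Module 𝕜 B] [TopologicalSpace B]

theorem eventually_add_smul_mem {Ω : Set A} (hΩ : IsOpen Ω) {x : A} (hx : x ∈ Ω) (u : A) :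
    ∀ᶠ t : 𝕜 in 𝓝 0, x + t • u ∈ Ω := by
  have h : Continuous fun t : 𝕜 => x + t • u := by fun_prop
  exact h.continuousAt.eventually_mem (hΩ.mem_nhds (by simpa using hx))

/-- On an open set all small `t` are admissible, so the frequency clause is automatic and an
ordinary limit of difference quotients remains. -/
theorem hasDirDeriv_iff_tendsto {f : A →. B} {Ω : Set A} (hΩ : IsOpen Ω) {g : A → B}
    (hg : ∀ x ∈ Ω, g x ∈ f x) {x : A} (hx : x ∈ Ω) {u : A} {y : B} :
    HasDirDeriv 𝕜 f u x y ↔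
      Tendsto (fun t : 𝕜 => t⁻¹ • (g (x + t • u) - g x)) (𝓝[≠] 0) (𝓝 y) := by
  have hev : ∀ᶠ t : 𝕜 in 𝓝[≠] 0, x + t • u ∈ Ω :=
    (eventually_add_smul_mem hΩ hx u).filter_mono nhdsWithin_le_nhds
  constructor
  · rintro ⟨a, ha, -, h⟩
    rw [Part.mem_unique ha (hg x hx)] at h
    refine tendsto_def.2 fun N hN => ?_
    filter_upwards [h N hN, hev] with t ht hxt using ht _ (hg _ hxt)
  · intro h
    refine ⟨g x, hg x hx, (hev.mono fun t ht => Part.dom_iff_mem.2 ⟨_, hg _ ht⟩).frequently, ?_⟩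
    intro N hN
    filter_upwards [h hN, hev] with t ht hxt c hc
    rw [Part.mem_unique hc (hg _ hxt)]
    exact ht

theorem mem_dirDeriv_of_tendsto [T2Space B] {f : A →. B} {Ω : Set A} (hΩ : IsOpen Ω) {g : A → B}
    (hg : ∀ x ∈ Ω, g x ∈ f x) {x : A} (hx : x ∈ Ω) {u : A} {y : B}
    (h : Tendsto (fun t : 𝕜 => t⁻¹ • (g (x + t • u) - g x)) (𝓝[≠] 0) (𝓝 y)) :
    y ∈ dirDeriv 𝕜 f u x := by
  have h' : ∃ y, HasDirDeriv 𝕜 f u x y := ⟨y, (hasDirDeriv_iff_tendsto hΩ hg hx).2 h⟩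
  exact ⟨h', tendsto_nhds_unique ((hasDirDeriv_iff_tendsto hΩ hg hx).1 h'.choose_spec) h⟩

theorem mem_iterDirDeriv_of_tendsto [T2Space B] {k : ℕ∞} {f : A →. B} {Ω : Set A} (hΩ : IsOpen Ω)
    {H : ∀ l : ℕ, A → (Fin l → A) → B} (h_zero : ∀ x ∈ Ω, ∀ u, H 0 x u ∈ f x)
    (h_succ : ∀ l : ℕ, ((l + 1 : ℕ) : ℕ∞) ≤ k → ∀ x ∈ Ω, ∀ u : Fin (l + 1) → A,
      Tendsto (fun t : 𝕜 => t⁻¹ • (H l (x + t • u (Fin.last l)) (Fin.init u) -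
        H l x (Fin.init u))) (𝓝[≠] 0) (𝓝 (H (l + 1) x u))) :
    ∀ l : ℕ, (l : ℕ∞) ≤ k → ∀ x ∈ Ω, ∀ u, H l x u ∈ iterDirDeriv 𝕜 f l u x
  | 0, _, x, hx, u => h_zero x hx u
  | l + 1, hl, x, hx, u => by
    have hl' : (l : ℕ∞) ≤ k := le_trans (by exact_mod_cast l.le_succ) hl
    exact mem_dirDeriv_of_tendsto hΩ (g := fun x => H l x (Fin.init u))
      (fun x hx => mem_iterDirDeriv_of_tendsto hΩ h_zero h_succ l hl' x hx _) hx
      (h_succ l hl x hx u)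

end DirectionalDerivatives

/-! ### Seminorm estimates for multilinear maps. -/

section Multilinear

variable {𝕜 : Type*} [RCLike 𝕜] {A : Type*} [AddCommGroup A] [Module 𝕜 A]
  {B : Type*} [NormedAddCommGroup B] [NormedSpace 𝕜 B] {l : ℕ}

/-- Homogeneity. Each `u i` is scaled by `q (u i) + δ` because `q (u i)` may vanish; then `δ → 0`.
-/
theorem norm_le_mul_prod_of_forall_le (P : MultilinearMap 𝕜 (fun _ : Fin l => A) B)
    (q : Seminorm 𝕜 A) {C : ℝ} (h : ∀ u : Fin l → A, (∀ i, q (u i) ≤ 1) → ‖P u‖ ≤ C)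
    (u : Fin l → A) : ‖P u‖ ≤ C * ∏ i, q (u i) := by
  have key : ∀ δ : ℝ, 0 < δ → ‖P u‖ ≤ C * ∏ i, (q (u i) + δ) := by
    intro δ hδ
    have hc : ∀ i, 0 < q (u i) + δ := fun i => by positivity
    set c : Fin l → 𝕜 := fun i => ((q (u i) + δ : ℝ) : 𝕜) with hcdef
    have hnc : ∀ i, ‖c i‖ = q (u i) + δ := fun i => by
      rw [hcdef]
      simp only [RCLike.norm_ofReal, abs_of_pos (hc i)]
    have hc0 : ∀ i, c i ≠ 0 := fun i => by
      rw [← norm_ne_zero_iff, hnc]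
      exact (hc i).ne'
    have hu : u = fun i => c i • ((c i)⁻¹ • u i) := by
      funext i
      rw [smul_smul, mul_inv_cancel₀ (hc0 i), one_smul]
    have hle := h (fun i => (c i)⁻¹ • u i) fun i => by
      rw [map_smul_eq_mul, norm_inv, hnc, inv_mul_le_iff₀ (hc i)]
      linarith
    calc ‖P u‖ = (∏ i, (q (u i) + δ)) * ‖P fun i => (c i)⁻¹ • u i‖ := by
          conv_lhs => rw [hu, P.map_smul_univ, norm_smul, norm_prod]
          simp only [hnc]
      _ ≤ (∏ i, (q (u i) + δ)) * C := by
          gcongr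
      _ = C * ∏ i, (q (u i) + δ) := mul_comm _ _
  have hcont : Continuous fun δ : ℝ => C * ∏ i, (q (u i) + δ) := by fun_prop
  have hlim := (hcont.tendsto 0).mono_left (nhdsWithin_le_nhds (s := Set.Ioi 0))
  simp only [add_zero] at hlim
  exact ge_of_tendsto hlim (eventually_nhdsWithin_of_forall fun δ hδ => key δ hδ)

theorem norm_map_sub_map_le (P : MultilinearMap 𝕜 (fun _ : Fin l => A) B)
    (q : Seminorm 𝕜 A) {C : ℝ} (hC : 0 ≤ C)
    (h : ∀ u : Fin l → A, (∀ i, q (u i) ≤ 1) → ‖P u‖ ≤ C) (u v : Fin l → A) :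
    ‖P u - P v‖ ≤
      C * ∑ i, ∏ j, if j = i then q (u i - v i) else max (q (u j)) (q (v j)) := by
  -- `A` carries no topology in this section, so `q` may serve as its norm and the estimate for
  -- seminormed spaces applies.
  let : SeminormedAddCommGroup A := q.toSeminormedAddCommGroup
  let : NormedSpace 𝕜 A := ⟨fun c x => (map_smul_eq_mul q c x).le⟩
  exact P.norm_image_sub_le_of_bound' hC (norm_le_mul_prod_of_forall_le P q h) u v

end Multilinear

/-! ### Differentials of `C^k_Π` maps and their pullbacks along affine plots. -/

section Jets

variable {𝕜 : Type*} [RCLike 𝕜] {A : Type*} [AddCommGroup A] [Module 𝕜 A] [TopologicalSpace A]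

/-- `D` is the sequence of differentials of the map `f` of class `C^k_Π`. -/
structure IsKellerJet {B : Type*} [AddCommGroup B] [Module 𝕜 B] [TopologicalSpace B]
    (k : ℕ∞) (f : A →. B)
    (D : ∀ l : ℕ, A → ContinuousMultilinearMap 𝕜 (fun _ : Fin l => A) B) : Prop where
  isOpen_dom : IsOpen f.Dom
  mem_iterDirDeriv : ∀ l : ℕ, (l : ℕ∞) ≤ k → ∀ x ∈ f.Dom, ∀ u : Fin l → A,
    D l x u ∈ iterDirDeriv 𝕜 f l u x
  uniform : ∀ l : ℕ, (l : ℕ∞) ≤ k → ∀ x ∈ f.Dom, ∀ W ∈ 𝓝 (0 : B), ∃ U ∈ 𝓝 (0 : A),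
    ∀ ε : ℝ, 0 < ε → ∃ V ∈ 𝓝 (0 : A), ∀ v ∈ V, x + v ∈ f.Dom ∧
      ∀ u : Fin l → A, (∀ i, u i ∈ U) → D l (x + v) u - D l x u ∈ (ε : 𝕜) • W

theorem IsKellerC.exists_jet {B : Type*} [AddCommGroup B] [Module 𝕜 B] [TopologicalSpace B]
    {k : ℕ∞} {f : A →. B} (h : IsKellerC 𝕜 k f) :
    ∃ D : ∀ l : ℕ, A → ContinuousMultilinearMap 𝕜 (fun _ : Fin l => A) B,
      IsKellerJet k f D := by
  have H : ∀ l : ℕ, ∃ D : A → ContinuousMultilinearMap 𝕜 (fun _ : Fin l => A) B,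
      (l : ℕ∞) ≤ k → (∀ x ∈ f.Dom, ∀ u : Fin l → A, D x u ∈ iterDirDeriv 𝕜 f l u x) ∧
      ∀ x ∈ f.Dom, ∀ W ∈ 𝓝 (0 : B), ∃ U ∈ 𝓝 (0 : A), ∀ ε : ℝ, 0 < ε →
        ∃ V ∈ 𝓝 (0 : A), ∀ v ∈ V, x + v ∈ f.Dom ∧
          ∀ u : Fin l → A, (∀ i, u i ∈ U) → D (x + v) u - D x u ∈ (ε : 𝕜) • W := by
    intro l
    by_cases hl : (l : ℕ∞) ≤ k
    · obtain ⟨D, hD⟩ := h.2 l hl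
      exact ⟨D, fun _ => hD⟩
    · exact ⟨fun _ => 0, fun h => absurd h hl⟩
  choose D hD using H
  exact ⟨D, h.1, fun l hl => (hD l hl).1, fun l hl => (hD l hl).2⟩

variable [IsTopologicalAddGroup A] [ContinuousSMul 𝕜 A]
  {B : Type*} [NormedAddCommGroup B] [NormedSpace 𝕜 B]
  {k : ℕ∞} {f : A →. B} {D : ∀ l : ℕ, A → ContinuousMultilinearMap 𝕜 (fun _ : Fin l => A) B}

namespace IsKellerJet

theorem mem_apply (h : IsKellerJet k f D) {x : A} (hx : x ∈ f.Dom) : D 0 x 0 ∈ f x :=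
  h.mem_iterDirDeriv 0 (by simp) x hx 0

/-- Condition `(π)` for the closed unit ball `W`. The essential point is that `U` is chosen before
`ε`. -/
theorem exists_nhds_eventually_le (h : IsKellerJet k f D) {l : ℕ} (hl : (l : ℕ∞) ≤ k) {x : A}
    (hx : x ∈ f.Dom) : ∃ U ∈ 𝓝 (0 : A), ∀ ε : ℝ, 0 < ε → ∀ᶠ x' in 𝓝 x,
      ∀ u : Fin l → A, (∀ i, u i ∈ U) → ‖D l x' u - D l x u‖ ≤ ε := by
  obtain ⟨U, hU, H⟩ := h.uniform l hl x hx _ (Metric.closedBall_mem_nhds (0 : B) one_pos)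
  refine ⟨U, hU, fun ε hε => ?_⟩
  obtain ⟨V, hV, hVU⟩ := H ε hε
  have hV' : ∀ᶠ x' in 𝓝 x, x' - x ∈ V := by
    have hc : ContinuousAt (fun x' : A => x' - x) x := by fun_prop
    exact hc (by simpa using hV)
  filter_upwards [hV'] with x' hx' u hu
  have := (hVU _ hx').2 u hu
  rw [add_sub_cancel] at this
  obtain ⟨w, hw, hw'⟩ := this
  rw [← hw']
  simp only [mem_closedBall_zero_iff] at hw
  simp only [norm_smul, RCLike.norm_ofReal, abs_of_pos hε]
  nlinarith

theorem tendsto_slope (h : IsKellerJet k f D) {l : ℕ} (hl : ((l + 1 : ℕ) : ℕ∞) ≤ k) {x : A}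
    (hx : x ∈ f.Dom) (u : Fin l → A) (v : A) :
    Tendsto (fun t : 𝕜 => t⁻¹ • (D l (x + t • v) u - D l x u)) (𝓝[≠] 0)
      (𝓝 (D (l + 1) x (Fin.snoc (α := fun _ => A) u v))) := by
  have hl' : (l : ℕ∞) ≤ k := le_trans (by exact_mod_cast l.le_succ) hl
  have h1 := h.mem_iterDirDeriv (l + 1) hl x hx (Fin.snoc (α := fun _ => A) u v)
  have h2 := hasDirDeriv_of_mem_dirDeriv h1
  rw [Fin.init_snoc, Fin.snoc_last] at h2
  exact (hasDirDeriv_iff_tendsto h.isOpen_dom (g := fun x => D l x u)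
    (fun x hx => h.mem_iterDirDeriv l hl' x hx u) hx).1 h2

end IsKellerJet

/-- The pullback of a sequence of differentials along the affine map `s ↦ a + L s`. The arguments
are reversed, since the differentials of `f` list the directions in the opposite order to
`iteratedFDeriv`. -/
noncomputable def plotSeries {S : Type*} [NormedAddCommGroup S] [NormedSpace 𝕜 S]
    (D : ∀ l : ℕ, A → ContinuousMultilinearMap 𝕜 (fun _ : Fin l => A) B)
    (a : A) (L : S →L[𝕜] A) (s : S) : FormalMultilinearSeries 𝕜 S B := fun l =>
  ((D l (a + L s)).compContinuousLinearMap fun _ => L).domDomCongr Fin.revPerm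

variable {S : Type*} [NormedAddCommGroup S] [NormedSpace 𝕜 S]

theorem plotSeries_apply (a : A) (L : S →L[𝕜] A) (s : S) (l : ℕ) (w : Fin l → S) :
    plotSeries D a L s l w = D l (a + L s) fun i => L (w i.rev) := rfl

theorem norm_le_of_forall_le_of_norm_le {l : ℕ}
    (P : ContinuousMultilinearMap 𝕜 (fun _ : Fin l => S) B) {r ε : ℝ} (hr : 0 < r) (hε : 0 ≤ ε)
    (h : ∀ u, (∀ i, ‖u i‖ ≤ r) → ‖P u‖ ≤ ε) : ‖P‖ ≤ ε * r⁻¹ ^ l := by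
  refine ContinuousMultilinearMap.opNorm_le_bound (by positivity) ?_
  refine norm_le_mul_prod_of_forall_le P.toMultilinearMap (normSeminorm 𝕜 S) fun u hu => ?_
  have hr' : (r : 𝕜) ≠ 0 := by exact_mod_cast hr.ne'
  have h1 := h (fun i => (r : 𝕜) • u i) fun i => by
    have := hu i
    rw [coe_normSeminorm] at this
    rw [norm_smul, RCLike.norm_ofReal, abs_of_pos hr]
    nlinarith
  rw [P.map_smul_univ, norm_smul, norm_prod] at h1
  simp only [RCLike.norm_ofReal, abs_of_pos hr, Finset.prod_const, Finset.card_univ,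
    Fintype.card_fin] at h1
  rw [inv_pow, ← div_eq_mul_inv, le_div_iff₀ (by positivity), mul_comm]
  exact h1

namespace IsKellerJet

/-- `U` pulls back to a ball of `S`, so `(π)` becomes continuity in operator norm; pointwise
continuity of the differentials would not suffice. -/
theorem continuousOn_plotSeries (h : IsKellerJet k f D) (a : A) (L : S →L[𝕜] A) {l : ℕ}
    (hl : (l : ℕ∞) ≤ k) :
    ContinuousOn (fun s => plotSeries D a L s l) {s | a + L s ∈ f.Dom} := by
  intro s hs
  refine ContinuousAt.continuousWithinAt ?_
  obtain ⟨U, hU, H⟩ := h.exists_nhds_eventually_le hl hs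
  have hLU : L ⁻¹' U ∈ 𝓝 (0 : S) := L.continuous.continuousAt (by simpa using hU)
  obtain ⟨r, hr, hrU⟩ := Metric.nhds_basis_closedBall.mem_iff.1 hLU
  rw [Metric.continuousAt_iff']
  intro ε hε
  have hδ : 0 < ε / 2 / r⁻¹ ^ l := by positivity
  have hcont : ContinuousAt (fun s => a + L s) s := by fun_prop
  filter_upwards [hcont.eventually (H _ hδ)] with s' hs'
  rw [dist_eq_norm]
  have := norm_le_of_forall_le_of_norm_le (plotSeries D a L s' l - plotSeries D a L s l) hr hδ.le
    fun u hu => by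
      rw [sub_apply, plotSeries_apply, plotSeries_apply]
      exact hs' _ fun i => hrU (by simpa using hu i.rev)
  refine this.trans_lt ?_
  rw [div_mul_cancel₀ _ (by positivity)]
  linarith

theorem hasDerivAt_plotSeries (h : IsKellerJet k f D) (a : A) (L : S →L[𝕜] A) {l : ℕ}
    (hl : ((l + 1 : ℕ) : ℕ∞) ≤ k) {s v : S} {t : 𝕜} (hs : a + L (s + t • v) ∈ f.Dom)
    (u : Fin l → S) :
    HasDerivAt (fun t : 𝕜 => plotSeries D a L (s + t • v) l u)
      ((plotSeries D a L (s + t • v) (l + 1)).curryLeft v u) t := by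
  rw [hasDerivAt_iff_tendsto_slope_zero]
  convert! h.tendsto_slope hl hs (fun i => L (u i.rev)) (L v) using 2
  · rename_i τ
    rw [plotSeries_apply, plotSeries_apply]
    simp only [map_add, map_smul, add_smul, add_assoc]
  · rw [ContinuousMultilinearMap.curryLeft_apply, plotSeries_apply]
    congr 2
    funext i
    refine Fin.lastCases ?_ (fun i => ?_) i
    · simp
    · simp [Fin.rev_castSucc]

/-- A directional derivative that is linear and continuous in operator norm is a Fréchet derivative,
by the mean value inequality. -/
theorem hasFDerivAt_plotSeries (h : IsKellerJet k f D) (a : A) (L : S →L[𝕜] A) {l : ℕ}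
    (hl : ((l + 1 : ℕ) : ℕ∞) ≤ k) {s : S} (hs : a + L s ∈ f.Dom) :
    HasFDerivAt (fun s => plotSeries D a L s l) (plotSeries D a L s (l + 1)).curryLeft s := by
  have hopen : IsOpen {s | a + L s ∈ f.Dom} := h.isOpen_dom.preimage (by fun_prop)
  rw [hasFDerivAt_iff_isLittleO_nhds_zero, Asymptotics.isLittleO_iff]
  intro ε hε
  have hc := (h.continuousOn_plotSeries a L hl).continuousAt (hopen.mem_nhds hs)
  rw [Metric.continuousAt_iff'] at hc
  obtain ⟨r, hr, hball⟩ := Metric.mem_nhds_iff.1 ((hc ε hε).and (hopen.mem_nhds hs))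
  filter_upwards [Metric.ball_mem_nhds (0 : S) hr] with v hv
  rw [mem_ball_zero_iff] at hv
  refine ContinuousMultilinearMap.opNorm_le_bound (by positivity) fun u => ?_
  have hmem : ∀ t ∈ Metric.closedBall (0 : 𝕜) 1, s + t • v ∈ Metric.ball s r := by
    intro t ht
    rw [mem_closedBall_zero_iff] at ht
    rw [mem_ball_iff_norm, add_sub_cancel_left, norm_smul]
    nlinarith [norm_nonneg v]
  -- With the linear part removed, the derivative of `g` is at most `ε * ‖v‖ * ∏ i, ‖u i‖`;
  -- comparing `t = 0` with `t = 1` gives the remainder estimate.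
  set g : 𝕜 → B := fun t => plotSeries D a L (s + t • v) l u -
    t • (plotSeries D a L s (l + 1)).curryLeft v u with hg
  have hd : ∀ t ∈ Metric.closedBall (0 : 𝕜) 1, HasDerivWithinAt g
      ((plotSeries D a L (s + t • v) (l + 1)).curryLeft v u -
        (plotSeries D a L s (l + 1)).curryLeft v u) (Metric.closedBall (0 : 𝕜) 1) t := by
    intro t ht
    have h1 := h.hasDerivAt_plotSeries a L hl (s := s) (v := v) (t := t) (hball (hmem t ht)).2 u
    have h2 := (hasDerivAt_id t).smul_const ((plotSeries D a L s (l + 1)).curryLeft v u)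
    rw [one_smul] at h2
    exact (h1.sub h2).hasDerivWithinAt
  have hb : ∀ t ∈ Metric.closedBall (0 : 𝕜) 1,
      ‖(plotSeries D a L (s + t • v) (l + 1)).curryLeft v u -
        (plotSeries D a L s (l + 1)).curryLeft v u‖ ≤ ε * ‖v‖ * ∏ i, ‖u i‖ := by
    intro t ht
    have h1 := (hball (hmem t ht)).1
    rw [dist_eq_norm] at h1
    simp only [ContinuousMultilinearMap.curryLeft_apply]
    rw [← sub_apply]
    refine (ContinuousMultilinearMap.le_opNorm _ _).trans ?_
    rw [Fin.prod_univ_succ, mul_assoc]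
    simp only [Fin.cons_zero, Fin.cons_succ]
    gcongr
  have := (convex_closedBall (0 : 𝕜) 1).norm_image_sub_le_of_norm_hasDerivWithin_le hd hb
    (by simp : (0 : 𝕜) ∈ _) (by simp : (1 : 𝕜) ∈ _)
  simp only [hg, sub_zero, norm_one, mul_one, one_smul, zero_smul, add_zero] at this
  refine le_of_eq_of_le ?_ this
  congr 1
  simp only [sub_apply]
  abel

theorem hasFTaylorSeriesUpToOn (h : IsKellerJet k f D) (a : A) (L : S →L[𝕜] A) :
    HasFTaylorSeriesUpToOn k (fun s => D 0 (a + L s) 0) (plotSeries D a L)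
      {s | a + L s ∈ f.Dom} where
  zero_eq s _ := by
    rw [ContinuousMultilinearMap.curry0, plotSeries_apply]
    congr 1
    exact Subsingleton.elim _ _
  fderivWithin l hl s hs :=
    (h.hasFDerivAt_plotSeries a L (by
      have : (l : ℕ∞) < k := by exact_mod_cast hl
      exact_mod_cast Order.add_one_le_of_lt this) hs).hasFDerivWithinAt
  cont l hl := h.continuousOn_plotSeries a L (by exact_mod_cast hl)

theorem contDiffAt (h : IsKellerJet k f D) (a : A) (L : S →L[𝕜] A) {s : S}
    (hs : a + L s ∈ f.Dom) : ContDiffAt 𝕜 k (fun s => D 0 (a + L s) 0) s :=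
  (h.hasFTaylorSeriesUpToOn a L).contDiffOn.contDiffAt
    ((h.isOpen_dom.preimage (by fun_prop : Continuous fun s => a + L s)).mem_nhds hs)

theorem iteratedFDeriv_apply (h : IsKellerJet k f D) (a : A) (L : S →L[𝕜] A) {s : S}
    (hs : a + L s ∈ f.Dom) {l : ℕ} (hl : (l : ℕ∞) ≤ k) (w : Fin l → S) :
    iteratedFDeriv 𝕜 l (fun s => D 0 (a + L s) 0) s w = D l (a + L s) fun i => L (w i.rev) := by
  have hopen : IsOpen {s | a + L s ∈ f.Dom} := h.isOpen_dom.preimage (by fun_prop)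
  rw [← plotSeries_apply, (h.hasFTaylorSeriesUpToOn a L).eq_iteratedFDerivWithin_of_uniqueDiffOn
    (by exact_mod_cast hl) hopen.uniqueDiffOn hs, iteratedFDerivWithin_of_isOpen l hopen hs]

end IsKellerJet

end Jets

/-! ### Continuous seminorms in locally convex spaces. -/

section Seminorms

variable {𝕜 : Type*} [RCLike 𝕜]
  {E : Type*} [AddCommGroup E] [Module 𝕜 E] [Module ℝ E] [IsScalarTower ℝ 𝕜 E]
  [TopologicalSpace E] [IsTopologicalAddGroup E] [ContinuousSMul 𝕜 E] [LocallyConvexSpace ℝ E]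

theorem exists_continuous_seminorm_of_mem_nhds {U : Set E} (hU : U ∈ 𝓝 (0 : E)) :
    ∃ q : Seminorm 𝕜 E, Continuous q ∧ ∀ x, q x ≤ 1 → x ∈ U := by
  have : ContinuousSMul ℝ E := IsScalarTower.continuousSMul 𝕜
  obtain ⟨s, ⟨hs, hsc⟩, hsU⟩ := (LocallyConvexSpace.convex_basis_zero ℝ E).mem_iff.1 hU
  -- The convex hull of a balanced set stays balanced over `𝕜`, so `t` has a `𝕜`-seminorm as gauge.
  set t := convexHull ℝ (balancedCore 𝕜 s) with ht
  have hts : t ⊆ s := convexHull_min (balancedCore_subset s) hsc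
  have ht0 : t ∈ 𝓝 (0 : E) :=
    mem_of_superset (balancedCore_mem_nhds_zero hs) (subset_convexHull ℝ _)
  have htc : Convex ℝ t := convex_convexHull ℝ _
  have htb : Balanced 𝕜 t := by
    intro c hc
    have hlin : IsLinearMap ℝ fun x : E => c • x :=
      ⟨fun x y => smul_add c x y, fun r x => by
        rw [← algebraMap_smul 𝕜 r x, ← algebraMap_smul 𝕜 r (c • x), smul_comm]⟩
    have himg : c • t = convexHull ℝ (c • balancedCore 𝕜 s) := hlin.image_convexHull _
    rw [himg]
    exact convexHull_mono (balancedCore_balanced s c hc)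
  -- The factor 2 turns `≤ 1` into `gauge t x < 1`, which is what puts `x` into `t`.
  refine ⟨(2 : NNReal) • gaugeSeminorm htb htc (absorbent_nhds_zero ht0), ?_, fun x hx => ?_⟩
  · change Continuous fun x => (2 : NNReal) • gauge t x
    exact (continuous_gauge htc ht0).const_smul _
  · change (2 : ℝ) * gauge t x ≤ 1 at hx
    refine hsU (hts (setOfPred_gauge_lt_one_subset_self htc (mem_of_mem_nhds ht0)
      (absorbent_nhds_zero ht0) ?_))
    change gauge t x < 1
    linarith

end Seminorms

/-! ### Derivatives along finite-dimensional affine plots. -/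

section Plots

variable {𝕜 : Type*} [RCLike 𝕜] {E : Type*} [AddCommGroup E] [Module 𝕜 E] [TopologicalSpace E]
  [IsTopologicalAddGroup E] [ContinuousSMul 𝕜 E]
  {B : Type*} [NormedAddCommGroup B] [NormedSpace 𝕜 B]

theorem iteratedFDeriv_comp_right_of_contDiffAt {S S' : Type*} [NormedAddCommGroup S]
    [NormedSpace 𝕜 S] [NormedAddCommGroup S'] [NormedSpace 𝕜 S'] {f : S → B} (M : S' →L[𝕜] S)
    {x : S'} {l : ℕ} (hf : ContDiffAt 𝕜 l f (M x)) :
    iteratedFDeriv 𝕜 l (f ∘ M) x =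
      (iteratedFDeriv 𝕜 l f (M x)).compContinuousLinearMap fun _ => M := by
  obtain ⟨u, hu, hfu⟩ := hf.contDiffOn le_rfl (by simp)
  obtain ⟨v, hvu, hv, hxv⟩ := mem_nhds_iff.1 (by simpa using hu : u ∈ 𝓝 (M x))
  have := M.iteratedFDerivWithin_comp_right (hfu.mono hvu) hv.uniqueDiffOn
    (hv.preimage M.continuous).uniqueDiffOn hxv le_rfl
  rwa [iteratedFDerivWithin_of_isOpen l (hv.preimage M.continuous) hxv,
    iteratedFDerivWithin_of_isOpen l hv hxv] at this

/-- The linear map `s ↦ ∑ i, s i • u i`. -/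
noncomputable def combination {n : ℕ} (u : Fin n → E) : (Fin n → 𝕜) →L[𝕜] E :=
  ∑ i, (ContinuousLinearMap.proj i : (Fin n → 𝕜) →L[𝕜] 𝕜).smulRight (u i)

theorem combination_apply {n : ℕ} (u : Fin n → E) (s : Fin n → 𝕜) :
    combination u s = ∑ i, s i • u i := by
  simp [combination, sum_apply]

theorem combination_single {n : ℕ} (u : Fin n → E) (i : Fin n) :
    combination u (Pi.single i 1 : Fin n → 𝕜) = u i := by
  rw [combination_apply, Finset.sum_eq_single i]
  · simp
  · intro j _ hj
    simp [hj]
  · simp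

/-- One plot captures any finite number of directions, so identities among finitely many derivatives
reduce to finite dimension. -/
theorem exists_plot {l m : ℕ} (u : Fin l → E) (v : Fin m → E) :
    ∃ (n : ℕ) (L : (Fin n → 𝕜) →L[𝕜] E) (w : Fin l → Fin n → 𝕜) (z : Fin m → Fin n → 𝕜),
      (∀ i, L (w i) = u i) ∧ ∀ j, L (z j) = v j :=
  ⟨l + m, combination (Fin.append u v), fun i => Pi.single (Fin.castAdd m i) 1,
    fun j => Pi.single (Fin.natAdd l j) 1, fun i => by simp [combination_single],
    fun j => by simp [combination_single]⟩

variable (𝕜) in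
/-- `g` is of class `C^k` along all affine maps from finite-dimensional spaces to `Ω`. -/
def PlotContDiffOn (k : ℕ∞) (g : E → B) (Ω : Set E) : Prop :=
  ∀ (n : ℕ) (L : (Fin n → 𝕜) →L[𝕜] E) (a : E) (s : Fin n → 𝕜), a + L s ∈ Ω →
    ContDiffAt 𝕜 k (fun s => g (a + L s)) s

variable (𝕜) in
/-- The iterated derivative of `g` at `x` in the directions `u`, in the order of
`iteratedFDeriv`. -/
noncomputable def plotDeriv (g : E → B) (l : ℕ) (x : E) (u : Fin l → E) : B :=
  iteratedFDeriv 𝕜 l (fun s : Fin l → 𝕜 => g (x + combination u s)) 0 fun i => Pi.single i 1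

theorem plotDeriv_zero (g : E → B) (x : E) (u : Fin 0 → E) : plotDeriv 𝕜 g 0 x u = g x := by
  simp [plotDeriv, combination_apply]

namespace PlotContDiffOn

variable {k : ℕ∞} {g : E → B} {Ω : Set E} {l : ℕ}

/-- Independence of the plot: the standard plot in the directions `L (w i)` factors through `L` by
the linear map `combination w`. -/
theorem iteratedFDeriv_apply (hg : PlotContDiffOn 𝕜 k g Ω) (hl : (l : ℕ∞) ≤ k) {n : ℕ}
    (L : (Fin n → 𝕜) →L[𝕜] E) {a : E} {s : Fin n → 𝕜} (hs : a + L s ∈ Ω)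
    (w : Fin l → Fin n → 𝕜) :
    iteratedFDeriv 𝕜 l (fun s => g (a + L s)) s w = plotDeriv 𝕜 g l (a + L s) fun i => L (w i) := by
  have h1 : (fun t : Fin l → 𝕜 => g (a + L s + combination (fun i => L (w i)) t)) =
      (fun s' => (fun s => g (a + L s)) (s + s')) ∘ combination w := by
    funext t
    simp only [Function.comp_apply, map_add, combination_apply, map_sum, map_smul, add_assoc]
  have h2 : ContDiffAt 𝕜 l (fun s => g (a + L s)) (s + combination w (0 : Fin l → 𝕜)) := by
    simpa using (hg n L a s hs).of_le (by exact_mod_cast hl)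
  have h3 : ContDiffAt 𝕜 l (fun s' => (fun s => g (a + L s)) (s + s'))
      (combination w (0 : Fin l → 𝕜)) :=
    h2.comp (combination w (0 : Fin l → 𝕜)) (contDiffAt_const.add contDiffAt_id)
  rw [plotDeriv, h1, iteratedFDeriv_comp_right_of_contDiffAt _ h3,
    iteratedFDeriv_comp_add_left (f := fun s => g (a + L s)) l s, map_zero, add_zero]
  simp [combination_single]

theorem plotDeriv_eq (hg : PlotContDiffOn 𝕜 k g Ω) (hl : (l : ℕ∞) ≤ k) {n : ℕ}
    (L : (Fin n → 𝕜) →L[𝕜] E) {x : E} (hx : x ∈ Ω) {u : Fin l → E} {w : Fin l → Fin n → 𝕜}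
    (hw : ∀ i, L (w i) = u i) :
    plotDeriv 𝕜 g l x u = iteratedFDeriv 𝕜 l (fun s => g (x + L s)) 0 w := by
  rw [hg.iteratedFDeriv_apply hl L (by simpa using hx)]
  simp [hw]

theorem plotDeriv_update_add (hg : PlotContDiffOn 𝕜 k g Ω) (hl : (l : ℕ∞) ≤ k) {x : E}
    (hx : x ∈ Ω) (u : Fin l → E) (i : Fin l) (a b : E) :
    plotDeriv 𝕜 g l x (Function.update u i (a + b)) =
      plotDeriv 𝕜 g l x (Function.update u i a) + plotDeriv 𝕜 g l x (Function.update u i b) := by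
  obtain ⟨n, L, w, z, hw, hz⟩ := exists_plot (𝕜 := 𝕜) u ![a, b]
  have key : ∀ (c : E) (c' : Fin n → 𝕜), L c' = c → ∀ j,
      L (Function.update w i c' j) = Function.update u i c j := by
    intro c c' hc j
    rcases eq_or_ne j i with rfl | hj
    · simpa using hc
    · simpa [hj] using hw j
  rw [hg.plotDeriv_eq hl L hx (key (a + b) (z 0 + z 1) (by simp [hz])),
    hg.plotDeriv_eq hl L hx (key a (z 0) (by simp [hz])),
    hg.plotDeriv_eq hl L hx (key b (z 1) (by simp [hz])),
    ContinuousMultilinearMap.map_update_add]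

theorem plotDeriv_update_smul (hg : PlotContDiffOn 𝕜 k g Ω) (hl : (l : ℕ∞) ≤ k) {x : E}
    (hx : x ∈ Ω) (u : Fin l → E) (i : Fin l) (c : 𝕜) (a : E) :
    plotDeriv 𝕜 g l x (Function.update u i (c • a)) =
      c • plotDeriv 𝕜 g l x (Function.update u i a) := by
  obtain ⟨n, L, w, z, hw, hz⟩ := exists_plot (𝕜 := 𝕜) u ![a]
  have key : ∀ (c : E) (c' : Fin n → 𝕜), L c' = c → ∀ j,
      L (Function.update w i c' j) = Function.update u i c j := by
    intro c c' hc j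
    rcases eq_or_ne j i with rfl | hj
    · simpa using hc
    · simpa [hj] using hw j
  rw [hg.plotDeriv_eq hl L hx (key (c • a) (c • z 0) (by simp [hz])),
    hg.plotDeriv_eq hl L hx (key a (z 0) (by simp [hz])),
    ContinuousMultilinearMap.map_update_smul]

/-- The iterated derivative of `g` at `x` as a multilinear map. -/
noncomputable def plotDerivMultilinear (hg : PlotContDiffOn 𝕜 k g Ω) (hl : (l : ℕ∞) ≤ k) {x : E}
    (hx : x ∈ Ω) : MultilinearMap 𝕜 (fun _ : Fin l => E) B where
  toFun := plotDeriv 𝕜 g l x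
  map_update_add' u i a b := by
    convert! hg.plotDeriv_update_add hl hx u i a b
  map_update_smul' u i c a := by
    convert! hg.plotDeriv_update_smul hl hx u i c a

theorem tendsto_slope_plotDeriv (hg : PlotContDiffOn 𝕜 k g Ω) (hΩ : IsOpen Ω)
    (hl : ((l + 1 : ℕ) : ℕ∞) ≤ k) {x : E} (hx : x ∈ Ω) (u : Fin l → E) (v : E) :
    Tendsto (fun t : 𝕜 => t⁻¹ • (plotDeriv 𝕜 g l (x + t • v) u - plotDeriv 𝕜 g l x u)) (𝓝[≠] 0)
      (𝓝 (plotDeriv 𝕜 g (l + 1) x (Fin.cons (α := fun _ => E) v u))) := by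
  have hl' : (l : ℕ∞) ≤ k := le_trans (by exact_mod_cast l.le_succ) hl
  obtain ⟨n, L, w, z, hw, hz⟩ := exists_plot (𝕜 := 𝕜) u ![v]
  have hz' : L (z 0) = v := hz 0
  have hd : HasFDerivAt (iteratedFDeriv 𝕜 l fun s => g (x + L s)) _ (0 + (0 : 𝕜) • z 0) :=
    ((hg n L x (0 + (0 : 𝕜) • z 0) (by simpa using hx)).differentiableAt_iteratedFDeriv
      (m := l) (by exact_mod_cast lt_of_lt_of_le (by exact_mod_cast l.lt_succ_self) hl)).hasFDerivAt
  have hline : HasDerivAt (fun t : 𝕜 => 0 + t • z 0) ((1 : 𝕜) • z 0) 0 :=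
    ((hasDerivAt_id (0 : 𝕜)).smul_const (z 0)).const_add 0
  have hcomp := hd.comp_hasDerivAt (0 : 𝕜) hline
  have happ := (ContinuousMultilinearMap.apply 𝕜 (fun _ : Fin l => Fin n → 𝕜) B w).hasFDerivAt
    |>.comp_hasDerivAt (0 : 𝕜) hcomp
  rw [hasDerivAt_iff_tendsto_slope_zero] at happ
  have hlim : plotDeriv 𝕜 g (l + 1) x (Fin.cons (α := fun _ => E) v u) =
      iteratedFDeriv 𝕜 (l + 1) (fun s => g (x + L s)) 0
        (Fin.cons (α := fun _ => Fin n → 𝕜) (z 0) w) :=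
    hg.plotDeriv_eq hl L hx fun i => by
      refine Fin.cases ?_ (fun i => ?_) i
      · simpa using hz'
      · simpa using hw i
  rw [hlim, iteratedFDeriv_succ_apply_left]
  refine Tendsto.congr' ?_ (by simpa using happ)
  -- Once `x + t • v` lies in `Ω`, the derivative based there can be read off from the plot based at
  -- `x`.
  have hev : ∀ᶠ t : 𝕜 in 𝓝[≠] 0, x + t • v ∈ Ω :=
    (eventually_add_smul_mem hΩ hx v).filter_mono nhdsWithin_le_nhds
  filter_upwards [hev] with t ht
  have ht' : x + L (t • z 0) ∈ Ω := by simpa [hz'] using ht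
  have e1 := hg.iteratedFDeriv_apply hl' L ht' w
  rw [map_smul, hz', funext hw] at e1
  rw [hg.plotDeriv_eq hl' L hx hw, ← e1]

end PlotContDiffOn

end Plots

/-! ### Uniform continuity on seminorm balls and its stability. -/

section UniformContinuity

variable {𝕜 : Type*} [RCLike 𝕜] {X : Type*} [TopologicalSpace X]
  {E : Type*} [AddCommGroup E] [Module 𝕜 E] {A : Type*} [AddCommGroup A] [Module 𝕜 A]
  {B : Type*} [NormedAddCommGroup B] [NormedSpace 𝕜 B] {l : ℕ}

/-- The functions `T x'` of `l` variables tend to `T x` as `x' → x`, uniformly on the unit ball of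
the seminorm `q`, and `T x` is bounded there. Sizes of values are measured by the seminorm `p`. -/
def UniformAt (q : Seminorm 𝕜 E) (p : Seminorm 𝕜 A) (T : X → (Fin l → E) → A) (x : X) : Prop :=
  (∃ C : ℝ, ∀ u : Fin l → E, (∀ i, q (u i) ≤ 1) → p (T x u) ≤ C) ∧
  ∀ ε : ℝ, 0 < ε → ∀ᶠ x' in 𝓝 x, ∀ u : Fin l → E, (∀ i, q (u i) ≤ 1) → p (T x' u - T x u) ≤ ε

namespace UniformAt

variable {q : Seminorm 𝕜 E} {p : Seminorm 𝕜 A} {x : X}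

theorem congr {T T' : X → (Fin l → E) → A} (hT : UniformAt q p T x)
    (h : ∀ᶠ x' in 𝓝 x, T x' = T' x') : UniformAt q p T' x := by
  have hx : T x = T' x := h.self_of_nhds
  refine ⟨hx ▸ hT.1, fun ε hε => ?_⟩
  filter_upwards [h, hT.2 ε hε] with x' h1 h2
  rwa [← hx, ← h1]

theorem zero : UniformAt q p (fun _ _ => 0 : X → (Fin l → E) → A) x :=
  ⟨⟨0, fun u _ => by simp⟩, fun ε hε => Eventually.of_forall fun x' u _ => by simpa using hε.le⟩

theorem add {T T' : X → (Fin l → E) → A} (hT : UniformAt q p T x) (hT' : UniformAt q p T' x) :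
    UniformAt q p (fun x u => T x u + T' x u) x := by
  obtain ⟨⟨C, hC⟩, h⟩ := hT
  obtain ⟨⟨C', hC'⟩, h'⟩ := hT'
  refine ⟨⟨C + C', fun u hu => (map_add_le_add p _ _).trans (add_le_add (hC u hu) (hC' u hu))⟩,
    fun ε hε => ?_⟩
  filter_upwards [h (ε / 2) (by positivity), h' (ε / 2) (by positivity)] with x' h1 h2 u hu
  calc p (T x' u + T' x' u - (T x u + T' x u))
      = p ((T x' u - T x u) + (T' x' u - T' x u)) := by congr 1; abel
    _ ≤ ε / 2 + ε / 2 := (map_add_le_add p _ _).trans (add_le_add (h1 u hu) (h2 u hu))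
    _ = ε := by ring

theorem neg {T : X → (Fin l → E) → A} (hT : UniformAt q p T x) :
    UniformAt q p (fun x u => -T x u) x := by
  obtain ⟨⟨C, hC⟩, h⟩ := hT
  refine ⟨⟨C, fun u hu => by simpa using hC u hu⟩, fun ε hε => ?_⟩
  filter_upwards [h ε hε] with x' h1 u hu
  rw [neg_sub_neg, map_sub_rev]
  exact h1 u hu

theorem sum {κ : Type*} (s : Finset κ) {T : κ → X → (Fin l → E) → A}
    (hT : ∀ c ∈ s, UniformAt q p (T c) x) : UniformAt q p (fun x u => ∑ c ∈ s, T c x u) x := by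
  classical
  induction s using Finset.induction_on with
  | empty => simpa using zero
  | insert c s hc ih =>
    simp only [Finset.sum_insert hc]
    exact (hT c (Finset.mem_insert_self c s)).add
      (ih fun c' hc' => hT c' (Finset.mem_insert_of_mem hc'))

theorem clm_apply {C : Type*} [NormedAddCommGroup C] [NormedSpace 𝕜 C] {L : X → B →L[𝕜] C}
    (hL : ContinuousAt L x) {T : X → (Fin l → E) → B}
    (hT : UniformAt q (normSeminorm 𝕜 B) T x) :
    UniformAt q (normSeminorm 𝕜 C) (fun x u => L x (T x u)) x := by
  obtain ⟨⟨K, hK⟩, h⟩ := hT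
  simp only [coe_normSeminorm] at hK h
  refine ⟨⟨‖L x‖ * K, fun u hu => ?_⟩, fun ε hε => ?_⟩
  · exact (L x).le_opNorm_of_le (hK u hu)
  have hM : 0 < |K| + 1 + ‖L x‖ := by positivity
  -- The bound 1 keeps `T x' u` below `|K| + 1`; the other bound makes the two error terms sum to at
  -- most `ε`.
  set η := min 1 (ε / (|K| + 1 + ‖L x‖)) with hη
  have hη0 : 0 < η := lt_min one_pos (by positivity)
  filter_upwards [h η hη0, Metric.continuousAt_iff'.1 hL η hη0] with x' h1 h2 u hu
  rw [dist_eq_norm] at h2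
  have h3 : ‖T x' u‖ ≤ |K| + 1 := by
    have e1 : T x' u = T x u + (T x' u - T x u) := by abel
    rw [e1]
    refine (norm_add_le _ _).trans (add_le_add ((hK u hu).trans (le_abs_self K)) ?_)
    exact (h1 u hu).trans (min_le_left _ _)
  calc ‖L x' (T x' u) - L x (T x u)‖ = ‖(L x' - L x) (T x' u) + L x (T x' u - T x u)‖ := by
        congr 1
        simp
    _ ≤ ‖(L x' - L x) (T x' u)‖ + ‖L x (T x' u - T x u)‖ := norm_add_le _ _
    _ ≤ η * (|K| + 1) + ‖L x‖ * η :=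
        add_le_add ((L x' - L x).le_of_opNorm_le_of_le h2.le h3) ((L x).le_opNorm_of_le (h1 u hu))
    _ = η * (|K| + 1 + ‖L x‖) := by ring
    _ ≤ ε / (|K| + 1 + ‖L x‖) * (|K| + 1 + ‖L x‖) := by
        gcongr
        exact min_le_right _ _
    _ = ε := div_mul_cancel₀ _ hM.ne'

/-- The error splits as `(Q x' - Q x) r' + (Q x r' - Q x r)`: homogeneity handles the first term,
replacing one argument at a time the second. Hence every term of the formula of Faà di Bruno
inherits uniformity. -/
theorem comp_multilinear {m : ℕ} {Q : X → MultilinearMap 𝕜 (fun _ : Fin m => A) B}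
    (hQ : UniformAt p (normSeminorm 𝕜 B) (fun x => Q x) x) {n : Fin m → ℕ}
    {R : ∀ i, X → (Fin (n i) → E) → A} (hR : ∀ i, UniformAt q p (R i) x)
    (e : ∀ i, Fin (n i) → Fin l) :
    UniformAt q (normSeminorm 𝕜 B) (fun x u => Q x fun i => R i x fun r => u (e i r)) x := by
  obtain ⟨⟨C, hC⟩, hQ⟩ := hQ
  choose K hK using fun i => (hR i).1
  simp only [coe_normSeminorm] at hC hQ
  -- `M` dominates every `K i + 1`, hence the inner values at both `x` and `x'`, as `η ≤ 1`.
  set M : ℝ := ∑ i, |K i| + 1 with hM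
  have hM1 : 1 ≤ M := le_add_of_nonneg_left (Finset.sum_nonneg fun i _ => abs_nonneg _)
  have hM0 : 0 ≤ M := zero_le_one.trans hM1
  have hKM : ∀ i, K i + 1 ≤ M := fun i => by
    have := Finset.single_le_sum (f := fun i => |K i|) (fun i _ => abs_nonneg _)
      (Finset.mem_univ i)
    have h2 := le_abs_self (K i)
    linarith
  have hC0 : ∀ u : Fin m → A, (∀ i, p (u i) ≤ 1) → ‖Q x u‖ ≤ |C| := fun u hu =>
    (hC u hu).trans (le_abs_self C)
  refine ⟨⟨|C| * ∏ i : Fin m, M, fun u hu => ?_⟩, fun ε hε => ?_⟩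
  · refine (norm_le_mul_prod_of_forall_le (Q x) p hC0 _).trans ?_
    gcongr with i
    linarith [hK i (fun r => u (e i r)) (fun r => hu _), hKM i]
  have hpos : 0 < (1 + |C| * m) * M ^ m := by positivity
  set η := min 1 (ε / ((1 + |C| * m) * M ^ m)) with hη
  have hη0 : 0 < η := lt_min one_pos (by positivity)
  filter_upwards [hQ η hη0, eventually_all.2 fun i => (hR i).2 η hη0] with x' h1 h2 u hu
  set r : Fin m → A := fun i => R i x fun r => u (e i r)
  set r' : Fin m → A := fun i => R i x' fun r => u (e i r)
  have hr : ∀ i, p (r i) ≤ M := fun i => by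
    linarith [hK i (fun r => u (e i r)) (fun r => hu _), hKM i]
  have hrr : ∀ i, p (r' i - r i) ≤ η := fun i => h2 i _ fun r => hu _
  have hr' : ∀ i, p (r' i) ≤ M := fun i => by
    have e1 : r' i = r i + (r' i - r i) := by abel
    rw [e1]
    have e2 : η ≤ 1 := min_le_left _ _
    linarith [map_add_le_add p (r i) (r' i - r i), hrr i,
      hK i (fun r => u (e i r)) (fun r => hu _), hKM i]
  have b1 : ‖Q x' r' - Q x r'‖ ≤ η * M ^ m := by
    have := norm_le_mul_prod_of_forall_le (Q x' - Q x) p (C := η) (fun u hu => h1 u hu) r'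
    refine this.trans ?_
    gcongr
    calc ∏ i, p (r' i) ≤ ∏ i : Fin m, M := by gcongr with i; exact hr' i
      _ = M ^ m := by simp
  have b2 : ‖Q x r' - Q x r‖ ≤ |C| * (m * (η * M ^ m)) := by
    refine (norm_map_sub_map_le (Q x) p (abs_nonneg C) hC0 r' r).trans ?_
    gcongr
    calc (∑ i, ∏ j, if j = i then p (r' i - r i) else max (p (r' j)) (p (r j)))
        ≤ ∑ i : Fin m, η * M ^ m := by
          gcongr with i
          calc (∏ j, if j = i then p (r' i - r i) else max (p (r' j)) (p (r j)))
              ≤ ∏ j, (if j = i then η else 1) * M := by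
                refine Finset.prod_le_prod (fun j _ => ?_) fun j _ => ?_
                · split_ifs
                  · exact apply_nonneg p _
                  · exact le_max_of_le_left (apply_nonneg p _)
                · split_ifs
                  · exact (hrr i).trans (le_mul_of_one_le_right hη0.le hM1)
                  · rw [one_mul]
                    exact max_le (hr' j) (hr j)
            _ = η * M ^ m := by
                rw [Finset.prod_mul_distrib]
                simp
      _ = m * (η * M ^ m) := by simp
  calc ‖Q x' r' - Q x r‖ = ‖(Q x' r' - Q x r') + (Q x r' - Q x r)‖ := by
        congr 1
        abel
    _ ≤ η * M ^ m + |C| * (m * (η * M ^ m)) := (norm_add_le _ _).trans (add_le_add b1 b2)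
    _ = η * ((1 + |C| * m) * M ^ m) := by ring
    _ ≤ ε / ((1 + |C| * m) * M ^ m) * ((1 + |C| * m) * M ^ m) := by
        gcongr
        exact min_le_right _ _
    _ = ε := div_mul_cancel₀ _ hpos.ne'

theorem mono {q' : Seminorm 𝕜 E} {T : X → (Fin l → E) → A} (hT : UniformAt q p T x)
    (hq : ∀ v, q v ≤ q' v) : UniformAt q' p T x := by
  obtain ⟨⟨C, hC⟩, h⟩ := hT
  refine ⟨⟨C, fun u hu => hC u fun i => (hq _).trans (hu i)⟩, fun ε hε => ?_⟩
  filter_upwards [h ε hε] with x' h1 u hu using h1 u fun i => (hq _).trans (hu i)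

theorem comp_continuousAt {Y : Type*} [TopologicalSpace Y] {φ : Y → X} {y : Y}
    {T : X → (Fin l → E) → A} (hT : UniformAt q p T (φ y)) (hφ : ContinuousAt φ y) :
    UniformAt q p (fun y => T (φ y)) y :=
  ⟨hT.1, fun ε hε => hφ.eventually (hT.2 ε hε)⟩

end UniformAt

/-- A multilinear map that is bounded on the unit ball of a continuous seminorm is continuous. -/
theorem continuous_of_bounded [TopologicalSpace E] [IsTopologicalAddGroup E]
    (P : MultilinearMap 𝕜 (fun _ : Fin l => E) B) {q : Seminorm 𝕜 E} (hq : Continuous q) {C : ℝ}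
    (h : ∀ u : Fin l → E, (∀ i, q (u i) ≤ 1) → ‖P u‖ ≤ C) : Continuous P := by
  refine continuous_iff_continuousAt.2 fun u => ?_
  rw [ContinuousAt, tendsto_iff_norm_sub_tendsto_zero]
  have hb : ∀ v, ‖P v - P u‖ ≤ |C| * ∑ i, ∏ j,
      if j = i then q (v i - u i) else max (q (v j)) (q (u j)) := fun v =>
    norm_map_sub_map_le P q (abs_nonneg C) (fun u hu => (h u hu).trans (le_abs_self C)) v u
  refine squeeze_zero (fun _ => norm_nonneg _) hb ?_
  have hcont : Continuous fun v : Fin l → E => |C| * ∑ i, ∏ j,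
      if j = i then q (v i - u i) else max (q (v j)) (q (u j)) := by
    refine continuous_const.mul (continuous_finsetSum _ fun i _ =>
      continuous_finsetProd _ fun j _ => ?_)
    split_ifs
    · exact hq.comp (by fun_prop)
    · exact (hq.comp (by fun_prop)).max continuous_const
  have hlim := hcont.tendsto u
  have hzero : (∑ i, ∏ j, if j = i then q (u i - u i) else max (q (u j)) (q (u j))) = 0 :=
    Finset.sum_eq_zero fun i _ => Finset.prod_eq_zero (Finset.mem_univ i) (by simp)
  rwa [hzero, mul_zero] at hlim

end UniformContinuity

/-! ### The one-block partition in the formula of Faà di Bruno. -/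

section OneBlock

theorem OrderedFinpartition.sum_partSize {l : ℕ} (c : OrderedFinpartition l) :
    ∑ m, c.partSize m = l := by
  simpa using c.sum_sigma_eq_sum (fun _ => (1 : ℕ))

/-- The ordered partition of `Fin l` with a single block. -/
def oneBlock (l : ℕ) (hl : 0 < l) : OrderedFinpartition l where
  length := 1
  partSize _ := l
  partSize_pos _ := hl
  emb _ i := i
  emb_strictMono _ := strictMono_id
  parts_strictMono := Subsingleton.strictMono _
  disjoint i _ j _ hij := absurd (Subsingleton.elim i j) hij
  cover x := ⟨0, x, rfl⟩

theorem eq_oneBlock_of_length_eq_one {l : ℕ} (hl : 0 < l) (c : OrderedFinpartition l)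
    (hc : c.length = 1) : c = oneBlock l hl := by
  have hs := OrderedFinpartition.sum_partSize c
  rcases c with ⟨length, partSize, _, emb, hemb, _, _, _⟩
  dsimp only at hc hs
  subst hc
  have h1 : partSize = fun _ => l := by
    funext i
    rw [Subsingleton.elim i 0]
    simpa using hs
  subst h1
  -- A strictly monotone map is determined by its range, and an injective self-map of `Fin l` has
  -- full range.
  have h2 : emb = fun _ i => i := by
    funext m i
    exact congrFun (((hemb m).range_inj strictMono_id).1 (by
      rw [Set.range_id]
      exact (Finite.surjective_of_injective (hemb m).injective).range_eq)) i
  subst h2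
  rfl

/-- Only the one-block partition involves the derivative of order `l` of the implicit function; this
makes the formula a recursion. -/
theorem partSize_lt_of_ne_oneBlock {l : ℕ} (hl : 0 < l) {c : OrderedFinpartition l}
    (hc : c ≠ oneBlock l hl) (m : Fin c.length) : c.partSize m < l := by
  have hs := OrderedFinpartition.sum_partSize c
  have hne : c.length ≠ 1 := fun h => hc (eq_oneBlock_of_length_eq_one hl c h)
  have hpos := c.length_pos hl
  have : ∃ m', m' ≠ m := by
    have : Nontrivial (Fin c.length) := Fin.nontrivial_iff_two_le.2 (by omega)
    exact exists_ne m
  obtain ⟨m', hm'⟩ := this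
  have h2 := Finset.add_le_sum (f := c.partSize) (fun _ _ => Nat.zero_le _)
    (Finset.mem_univ m) (Finset.mem_univ m') hm'.symm
  have := c.partSize_pos m'
  omega

end OneBlock

/-! ### The partial differential `∂₂` and its continuity. -/

section PartialDerivative

variable {𝕜 : Type*} [RCLike 𝕜]
  {E : Type*} [AddCommGroup E] [Module 𝕜 E] [TopologicalSpace E]
  [IsTopologicalAddGroup E] [ContinuousSMul 𝕜 E]
  {G : Type*} [NormedAddCommGroup G] [NormedSpace 𝕜 G]
  {B : Type*} [NormedAddCommGroup B] [NormedSpace 𝕜 B]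
  {k : ℕ∞} {f : E × G →. B}
  {D : ∀ l : ℕ, E × G → ContinuousMultilinearMap 𝕜 (fun _ : Fin l => E × G) B}

/-- The partial differential `∂₂ f` obtained from the sequence of differentials of `f`. -/
noncomputable def partialDeriv₂
    (D : ∀ l : ℕ, E × G → ContinuousMultilinearMap 𝕜 (fun _ : Fin l => E × G) B) (z : E × G) :
    G →L[𝕜] B :=
  ((D 1 z).toContinuousLinearMap 0 0).comp (ContinuousLinearMap.inr 𝕜 E G)

theorem partialDeriv₂_apply (z : E × G) (v : G) :
    partialDeriv₂ D z v = D 1 z fun _ => (0, v) := by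
  rw [partialDeriv₂]
  change D 1 z (Function.update 0 0 (0, v)) = _
  congr 1
  funext i
  rw [Subsingleton.elim i 0, Function.update_self]

namespace IsKellerJet

theorem isPartialDeriv₂ (h : IsKellerJet k f D) (hk : 1 ≤ k) {z : E × G} (hz : z ∈ f.Dom) :
    IsPartialDeriv₂ 𝕜 f z (partialDeriv₂ D z) := fun v => by
  rw [partialDeriv₂_apply]
  exact h.mem_iterDirDeriv 1 (by exact_mod_cast hk) z hz fun _ => (0, v)

theorem eq_partialDeriv₂ (h : IsKellerJet k f D) (hk : 1 ≤ k) {z : E × G} (hz : z ∈ f.Dom)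
    {ℓ : G → B} (hℓ : IsPartialDeriv₂ 𝕜 f z ℓ) : ℓ = partialDeriv₂ D z :=
  funext fun v => Part.mem_unique (hℓ v) (h.isPartialDeriv₂ hk hz v)

theorem continuousAt_apply (h : IsKellerJet k f D) {z : E × G}
    (hz : z ∈ f.Dom) : ContinuousAt (fun z => D 0 z 0) z := by
  obtain ⟨U, hU, H⟩ := h.exists_nhds_eventually_le (l := 0) (by simp) hz
  rw [Metric.continuousAt_iff']
  intro ε hε
  filter_upwards [H (ε / 2) (by positivity)] with z' hz'
  rw [dist_eq_norm]
  linarith [hz' 0 fun i => i.elim0]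

theorem continuousAt_partialDeriv₂ (h : IsKellerJet k f D)
    (hk : 1 ≤ k) {z : E × G} (hz : z ∈ f.Dom) : ContinuousAt (partialDeriv₂ D) z := by
  obtain ⟨U, hU, H⟩ := h.exists_nhds_eventually_le (l := 1) (by exact_mod_cast hk) hz
  have hU' : ContinuousLinearMap.inr 𝕜 E G ⁻¹' U ∈ 𝓝 (0 : G) :=
    (ContinuousLinearMap.inr 𝕜 E G).continuous.continuousAt (by rwa [map_zero])
  obtain ⟨r, hr, hrU⟩ := Metric.mem_nhds_iff.1 hU'
  rw [Metric.continuousAt_iff']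
  intro ε hε
  have hδ : 0 < ε * r / 4 := by positivity
  filter_upwards [H _ hδ] with z' hz'
  rw [dist_eq_norm]
  -- On the shell `r / 2 ≤ ‖v‖ < r` one has `ε * r / 4 ≤ ε / 2 * ‖v‖`.
  refine lt_of_le_of_lt (ContinuousLinearMap.opNorm_le_of_shell (C := ε / 2) hr (by positivity)
    (c := (2 : 𝕜)) (by simp) fun v hv hvr => ?_) (by linarith : ε / 2 < ε)
  rw [sub_apply, partialDeriv₂_apply, partialDeriv₂_apply]
  refine (hz' _ fun _ => hrU (by simpa using hvr)).trans ?_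
  rw [RCLike.norm_ofNat] at hv
  nlinarith

end IsKellerJet

end PartialDerivative

/-! ### Seminorms witnessing `(π)`. -/

section JetSeminorms

variable {𝕜 : Type*} [RCLike 𝕜] {A : Type*} [AddCommGroup A] [Module 𝕜 A] [TopologicalSpace A]
  [IsTopologicalAddGroup A] [ContinuousSMul 𝕜 A] {B : Type*} [NormedAddCommGroup B] [NormedSpace 𝕜 B]
  {k : ℕ∞} {f : A →. B} {D : ∀ l : ℕ, A → ContinuousMultilinearMap 𝕜 (fun _ : Fin l => A) B}

theorem exists_nhds_forall_norm_le {l : ℕ} (P : ContinuousMultilinearMap 𝕜 (fun _ : Fin l => A) B) :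
    ∃ U ∈ 𝓝 (0 : A), ∀ u : Fin l → A, (∀ i, u i ∈ U) → ‖P u‖ ≤ ‖P 0‖ + 1 := by
  have hc : ContinuousAt (fun u => ‖P u‖) 0 := P.cont.norm.continuousAt
  have hev : ∀ᶠ u in 𝓝 (0 : Fin l → A), ‖P u‖ ≤ ‖P 0‖ + 1 :=
    hc.eventually (eventually_le_nhds (lt_add_one _))
  rw [nhds_pi] at hev
  obtain ⟨I, -, t, ht, htI⟩ := Filter.mem_pi.1 hev
  refine ⟨⋂ i, t i, (Filter.iInter_mem).2 ht, fun u hu => htI fun i _ => ?_⟩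
  exact Set.mem_iInter.1 (hu i) i

theorem IsKellerJet.exists_seminorm_uniformAt (h : IsKellerJet k f D)
    (hA : ∀ U ∈ 𝓝 (0 : A), ∃ p : Seminorm 𝕜 A, Continuous p ∧ ∀ x, p x ≤ 1 → x ∈ U)
    {l : ℕ} (hl : (l : ℕ∞) ≤ k) {z : A} (hz : z ∈ f.Dom) :
    ∃ p : Seminorm 𝕜 A, Continuous p ∧
      UniformAt p (normSeminorm 𝕜 B) (fun z u => D l z u) z := by
  obtain ⟨U, hU, H⟩ := h.exists_nhds_eventually_le hl hz
  obtain ⟨U', hU', H'⟩ := exists_nhds_forall_norm_le (D l z)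
  obtain ⟨p, hp, hpU⟩ := hA _ (inter_mem hU hU')
  refine ⟨p, hp, ⟨_, fun u hu => H' u fun i => (hpU _ (hu i)).2⟩, fun ε hε => ?_⟩
  filter_upwards [H ε hε] with z' hz' u hu using hz' u fun i => (hpU _ (hu i)).1

/-- The induction on the order uses all differentials of order at most `l` against one unit ball; a
maximum of seminorms provides it. -/
theorem IsKellerJet.exists_seminorm_forall_uniformAt (h : IsKellerJet k f D)
    (hA : ∀ U ∈ 𝓝 (0 : A), ∃ p : Seminorm 𝕜 A, Continuous p ∧ ∀ x, p x ≤ 1 → x ∈ U)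
    {l : ℕ} (hl : (l : ℕ∞) ≤ k) {z : A} (hz : z ∈ f.Dom) :
    ∃ p : Seminorm 𝕜 A, Continuous p ∧
      ∀ m ≤ l, UniformAt p (normSeminorm 𝕜 B) (fun z u => D m z u) z := by
  induction l with
  | zero =>
    obtain ⟨p, hp, H⟩ := h.exists_seminorm_uniformAt hA hl hz
    refine ⟨p, hp, fun m hm => ?_⟩
    obtain rfl : m = 0 := by omega
    exact H
  | succ l ih =>
    obtain ⟨p, hp, H⟩ := ih (le_trans (by exact_mod_cast l.le_succ) hl)
    obtain ⟨p', hp', H'⟩ := h.exists_seminorm_uniformAt hA hl hz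
    refine ⟨p ⊔ p', hp.max hp', fun m hm => ?_⟩
    rcases Nat.lt_or_ge l m with hlm | hlm
    · obtain rfl : m = l + 1 := by omega
      exact H'.mono fun v => le_max_right _ _
    · exact (H m hlm).mono fun v => le_max_left _ _

end JetSeminorms

theorem exists_continuous_seminorm_of_mem_nhds_prod {𝕜 : Type*} [RCLike 𝕜]
    {E : Type*} [AddCommGroup E] [Module 𝕜 E] [Module ℝ E] [IsScalarTower ℝ 𝕜 E]
    [TopologicalSpace E] [IsTopologicalAddGroup E] [ContinuousSMul 𝕜 E] [LocallyConvexSpace ℝ E]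
    {G : Type*} [NormedAddCommGroup G] [NormedSpace 𝕜 G] {U : Set (E × G)}
    (hU : U ∈ 𝓝 (0 : E × G)) :
    ∃ p : Seminorm 𝕜 (E × G), Continuous p ∧ ∀ x, p x ≤ 1 → x ∈ U := by
  obtain ⟨U₁, hU₁, U₂, hU₂, hUU⟩ := mem_nhds_prod_iff.1 hU
  obtain ⟨q, hq, hqU⟩ := exists_continuous_seminorm_of_mem_nhds (𝕜 := 𝕜) hU₁
  obtain ⟨δ, hδ, hδU⟩ := Metric.nhds_basis_closedBall.mem_iff.1 hU₂
  obtain ⟨d, hd⟩ : ∃ d : NNReal, (d : ℝ) = δ⁻¹ := ⟨⟨δ⁻¹, by positivity⟩, rfl⟩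
  refine ⟨q.comp (LinearMap.fst 𝕜 E G) ⊔
    (d • normSeminorm 𝕜 G).comp (LinearMap.snd 𝕜 E G), ?_, ?_⟩
  · change Continuous fun x : E × G => max (q x.1) ((d : ℝ) * ‖x.2‖)
    fun_prop
  · intro x hx
    change max (q x.1) ((d : ℝ) * ‖x.2‖) ≤ 1 at hx
    obtain ⟨h1, h2⟩ := max_le_iff.1 hx
    refine hUU ⟨hqU _ h1, hδU ?_⟩
    rw [hd, inv_mul_le_iff₀ hδ, mul_one] at h2
    simpa using h2

/-! ### Smoothness of a continuous implicit function. -/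

section ImplicitSmooth

/-- The `l`-th derivative of the identity, for `l ≥ 1`. -/
def idDeriv {E : Type*} [Zero E] : (l : ℕ) → (Fin l → E) → E
  | 1, u => u 0
  | _, _ => 0

theorem iteratedFDeriv_id_apply {𝕜 S : Type*} [RCLike 𝕜] [NormedAddCommGroup S] [NormedSpace 𝕜 S]
    {l : ℕ} (hl : 0 < l) (x : S) (w : Fin l → S) :
    iteratedFDeriv 𝕜 l (fun s : S => s) x w = idDeriv l w := by
  match l, w with
  | 1, w => simp [idDeriv]
  | l + 2, w =>
    rw [iteratedFDeriv_succ_apply_right]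
    have : (fun y : S => fderiv 𝕜 (fun s : S => s) y) = fun _ => ContinuousLinearMap.id 𝕜 S := by
      funext y
      exact fderiv_fun_id
    rw [this, iteratedFDeriv_succ_const]
    simp [idDeriv]

theorem map_idDeriv {E S Φ : Type*} [Zero E] [Zero S] [FunLike Φ S E] [ZeroHomClass Φ S E]
    (L : Φ) {l : ℕ} (w : Fin l → S) : L (idDeriv l w) = idDeriv l fun i => L (w i) := by
  match l, w with
  | 0, w => exact map_zero L
  | 1, w => rfl
  | l + 2, w => exact map_zero L

theorem apply_idDeriv_le {𝕜 E : Type*} [RCLike 𝕜] [AddCommGroup E] [Module 𝕜 E]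
    (q : Seminorm 𝕜 E) {l : ℕ} (u : Fin l → E) (hu : ∀ i, q (u i) ≤ 1) : q (idDeriv l u) ≤ 1 := by
  match l, u with
  | 0, u => simp [idDeriv]
  | 1, u => exact hu 0
  | l + 2, u => simp [idDeriv]

theorem isInvertible_of_bijective {𝕜 G : Type*} [RCLike 𝕜] [NormedAddCommGroup G]
    [NormedSpace 𝕜 G] [CompleteSpace G] {L : G →L[𝕜] G} (hL : Function.Bijective L) :
    L.IsInvertible :=
  ⟨ContinuousLinearEquiv.ofBijective L (LinearMap.ker_eq_bot.2 hL.1)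
    (LinearMap.range_eq_top.2 hL.2), ContinuousLinearEquiv.coe_ofBijective L _ _⟩

variable {𝕜 : Type*} [RCLike 𝕜]
  {E : Type*} [AddCommGroup E] [Module 𝕜 E] [TopologicalSpace E] [IsTopologicalAddGroup E]
  [ContinuousSMul 𝕜 E]
  {G : Type*} [NormedAddCommGroup G] [NormedSpace 𝕜 G] [CompleteSpace G]

/-- These pairs are the derivatives of `x ↦ (x, g x)`. The first entry does not depend on `x` and
cancels in differences; the second is controlled by `p (0, y) ≤ c * ‖y‖`. -/
theorem UniformAt.pair {X : Type*} [TopologicalSpace X] {x : X} {p : Seminorm 𝕜 (E × G)}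
    (hp : Continuous p) {l : ℕ} {T : X → (Fin l → E) → G}
    (hT : UniformAt (p.comp (LinearMap.inl 𝕜 E G)) (normSeminorm 𝕜 G) T x) :
    UniformAt (p.comp (LinearMap.inl 𝕜 E G)) p (fun x u => (idDeriv l u, T x u)) x := by
  obtain ⟨c, hc, hpc⟩ := Seminorm.bound_of_continuous_normedSpace
    (p.comp (LinearMap.inr 𝕜 E G)) (hp.comp (by fun_prop : Continuous fun y : G => ((0 : E), y)))
  have hpc' : ∀ y : G, p (0, y) ≤ c * ‖y‖ := hpc
  obtain ⟨⟨C, hC⟩, h⟩ := hT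
  simp only [coe_normSeminorm] at hC h
  refine ⟨⟨1 + c * C, fun u hu => ?_⟩, fun ε hε => ?_⟩
  · have h1 : p (idDeriv l u, 0) ≤ 1 := apply_idDeriv_le (p.comp (LinearMap.inl 𝕜 E G)) u hu
    have h2 : p (0, T x u) ≤ c * C :=
      (hpc' _).trans (mul_le_mul_of_nonneg_left (hC u hu) hc.le)
    calc p (idDeriv l u, T x u) = p ((idDeriv l u, 0) + (0, T x u)) := by simp
      _ ≤ 1 + c * C := (map_add_le_add p _ _).trans (add_le_add h1 h2)
  · filter_upwards [h (ε / c) (by positivity)] with x' hx' u hu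
    rw [Prod.mk_sub_mk, sub_self]
    refine (hpc' _).trans ((mul_le_mul_of_nonneg_left (hx' u hu) hc.le).trans ?_)
    rw [mul_div_cancel₀ _ hc.ne']

variable {k : ℕ∞} {f : E × G →. G}
  {D : ∀ l : ℕ, E × G → ContinuousMultilinearMap 𝕜 (fun _ : Fin l => E × G) G}
  {Ω : Set E} {g : E → G} {b : G}

namespace IsKellerJet

theorem apply_eq (h : IsKellerJet k f D) {z : E × G} (hz : b ∈ f z) : D 0 z 0 = b :=
  Part.mem_unique (h.mem_apply (Part.dom_iff_mem.2 ⟨b, hz⟩)) hz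

/-- An affine map from a normed space to `E`, extended by the identity of `G`. -/
theorem plot_apply {S : Type*} [NormedAddCommGroup S] [NormedSpace 𝕜 S] (a : E) (L : S →L[𝕜] E)
    (w : S × G) :
    (a, (0 : G)) + (L.prodMap (ContinuousLinearMap.id 𝕜 G)) w = (a + L w.1, w.2) :=
  Prod.ext (by simp) (by simp)

/-- Along a plot the equation lives on a Banach space, where the classical theorem applies.
Continuity of `g` keeps its graph in the region of local uniqueness, so `g` agrees with the
classical implicit function. -/
theorem plotContDiffOn_implicit (h : IsKellerJet k f D) (hk : 1 ≤ k) (hΩ : IsOpen Ω)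
    (hg : ContinuousOn g Ω) (hb : ∀ x ∈ Ω, b ∈ f (x, g x))
    (hbij : ∀ x ∈ Ω, Function.Bijective (partialDeriv₂ D (x, g x))) :
    PlotContDiffOn 𝕜 k g Ω := by
  intro n L a s hs
  set M := L.prodMap (ContinuousLinearMap.id 𝕜 G) with hM
  set F : (Fin n → 𝕜) × G → G := fun w => D 0 ((a, 0) + M w) 0 with hF
  have hFapp : ∀ w, F w = D 0 (a + L w.1, w.2) 0 := fun w => by
    rw [hF, hM]
    simp only [plot_apply]
  set y := g (a + L s) with hy
  have hdom : (a, (0 : G)) + M (s, y) ∈ f.Dom := by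
    rw [hM, plot_apply]
    exact Part.dom_iff_mem.2 ⟨b, hb _ hs⟩
  have hcd : ContDiffAt 𝕜 k F (s, y) := h.contDiffAt (a, 0) M hdom
  have hfd : fderiv 𝕜 F (s, y) ∘L .inr 𝕜 (Fin n → 𝕜) G = partialDeriv₂ D (a + L s, y) := by
    ext v
    have h1 := h.iteratedFDeriv_apply (a, 0) M hdom (l := 1) (by exact_mod_cast hk)
      fun _ => (0, v)
    rw [iteratedFDeriv_one_apply] at h1
    rw [ContinuousLinearMap.comp_apply, ContinuousLinearMap.inr_apply, partialDeriv₂_apply]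
    refine h1.trans ?_
    rw [hM, plot_apply]
    simp
  have hinv : (fderiv 𝕜 F (s, y) ∘L .inr 𝕜 (Fin n → 𝕜) G).IsInvertible := by
    rw [hfd]
    exact isInvertible_of_bijective (hbij _ hs)
  have hk0 : ((k : ℕ∞) : WithTop ℕ∞) ≠ 0 := by
    intro h0
    have : k = 0 := by exact_mod_cast h0
    simp [this] at hk
  have hcont : ContinuousAt (fun s => (s, g (a + L s))) s :=
    continuousAt_id.prodMk (ContinuousAt.comp (f := fun s => a + L s)
      (hg.continuousAt (hΩ.mem_nhds hs)) (by fun_prop))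
  have hmem : ∀ᶠ s' in 𝓝 s, a + L s' ∈ Ω :=
    (by fun_prop : ContinuousAt (fun s => a + L s) s).eventually_mem (hΩ.mem_nhds hs)
  have hev := hcont.eventually (hcd.eventually_apply_eq_iff_implicitFunction hk0 hinv)
  refine (hcd.contDiffAt_implicitFunction hk0 hinv).congr_of_eventuallyEq ?_
  filter_upwards [hev, hmem] with s' h1 h2
  refine (h1.1 ?_).symm
  rw [hFapp, hFapp]
  exact (h.apply_eq (hb _ h2)).trans (h.apply_eq (hb _ hs)).symm

/-- Differentiating `f (x, g x) = b` repeatedly, by the formula of Faà di Bruno. -/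
theorem sum_partitions_eq_zero (h : IsKellerJet k f D) (hΩ : IsOpen Ω)
    (hgk : PlotContDiffOn 𝕜 k g Ω) (hb : ∀ x ∈ Ω, b ∈ f (x, g x)) {l : ℕ} (hl0 : 0 < l)
    (hl : (l : ℕ∞) ≤ k) {x : E} (hx : x ∈ Ω) (u : Fin l → E) :
    ∑ c : OrderedFinpartition l, D c.length (x, g x) (fun m =>
      (idDeriv (c.partSize m.rev) fun r => u (c.emb m.rev r),
        plotDeriv 𝕜 g (c.partSize m.rev) x fun r => u (c.emb m.rev r))) = 0 := by
  set L : (Fin l → 𝕜) →L[𝕜] E := combination u with hL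
  set M := L.prodMap (ContinuousLinearMap.id 𝕜 G) with hM
  set F : (Fin l → 𝕜) × G → G := fun w => D 0 ((x, 0) + M w) 0 with hF
  set Γ : (Fin l → 𝕜) → (Fin l → 𝕜) × G := fun s => (s, g (x + L s)) with hΓ
  have hx0 : x + L 0 ∈ Ω := by simpa using hx
  have hMΓ : ∀ s, (x, (0 : G)) + M (Γ s) = (x + L s, g (x + L s)) := fun s => by
    rw [hM, plot_apply]
  have hMΓ0 : (x, (0 : G)) + M (Γ 0) = (x, g x) := by rw [hMΓ]; simp
  have hdom : (x, (0 : G)) + M (Γ 0) ∈ f.Dom := by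
    rw [hMΓ0]
    exact Part.dom_iff_mem.2 ⟨b, hb _ hx⟩
  have hgs : ContDiffAt 𝕜 k (fun s => g (x + L s)) 0 := hgk l L x 0 hx0
  have hmem : ∀ᶠ s in 𝓝 (0 : Fin l → 𝕜), x + L s ∈ Ω :=
    (by fun_prop : ContinuousAt (fun s => x + L s) 0).eventually_mem (hΩ.mem_nhds hx0)
  have hconst : F ∘ Γ =ᶠ[𝓝 0] fun _ => b := by
    filter_upwards [hmem] with s hs
    change D 0 ((x, 0) + M (Γ s)) 0 = b
    rw [hMΓ]
    exact h.apply_eq (hb _ hs)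
  have hzero : iteratedFDeriv 𝕜 l (F ∘ Γ) 0 = 0 := by
    rw [(hconst.iteratedFDeriv 𝕜 l).self_of_nhds, iteratedFDeriv_const_of_ne hl0.ne']
    rfl
  have hl' : ((l : ℕ) : WithTop ℕ∞) ≤ (k : WithTop ℕ∞) := by exact_mod_cast hl
  rw [iteratedFDeriv_comp (h.contDiffAt (x, 0) M hdom) (contDiffAt_id.prodMk hgs) hl'] at hzero
  have happ := congrArg (fun P => P fun i => Pi.single i (1 : 𝕜)) hzero
  simp only [FormalMultilinearSeries.taylorComp, sum_apply, zero_apply] at happ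
  rw [← happ]
  refine Finset.sum_congr rfl fun c _ => ?_
  rw [FormalMultilinearSeries.compAlongOrderedFinpartition_apply]
  have hc : (c.length : ℕ∞) ≤ k := le_trans (by exact_mod_cast c.length_le) hl
  -- `D` lists directions in the order opposite to `iteratedFDeriv`; hence the blocks appear as
  -- `m.rev`.
  have h1 := h.iteratedFDeriv_apply (x, 0) M hdom hc
    (c.applyOrderedFinpartition (fun m => ftaylorSeries 𝕜 Γ 0 (c.partSize m))
      fun i => Pi.single i (1 : 𝕜))
  refine Eq.trans ?_ h1.symm
  rw [hMΓ0]
  congr 1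
  funext m
  have hp : (c.partSize m.rev : ℕ∞) ≤ k := le_trans (by exact_mod_cast c.partSize_le _) hl
  rw [OrderedFinpartition.applyOrderedFinpartition_apply]
  change _ = M (iteratedFDeriv 𝕜 (c.partSize m.rev) Γ 0 fun r => Pi.single (c.emb m.rev r) 1)
  rw [hΓ, iteratedFDeriv_prodMk (f := fun s => s) contDiffAt_id hgs (by exact_mod_cast hp),
    ContinuousMultilinearMap.prod_apply, hM, ContinuousLinearMap.coe_prodMap', Prod.map_apply,
    hgk.iteratedFDeriv_apply hp L hx0]
  simp only [ContinuousLinearMap.coe_id', id_eq, map_zero, add_zero]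
  rw [iteratedFDeriv_id_apply (c.partSize_pos _), map_idDeriv]
  simp only [hL, combination_single]

/-- The one-block term is affine in the top derivative with linear part `∂₂ f`; all other terms
contain lower derivatives only. -/
theorem partialDeriv₂_plotDeriv (h : IsKellerJet k f D) (hΩ : IsOpen Ω)
    (hgk : PlotContDiffOn 𝕜 k g Ω) (hb : ∀ x ∈ Ω, b ∈ f (x, g x)) {l : ℕ} (hl0 : 0 < l)
    (hl : (l : ℕ∞) ≤ k) {x : E} (hx : x ∈ Ω) (u : Fin l → E) [DecidableEq (OrderedFinpartition l)] :
    partialDeriv₂ D (x, g x) (plotDeriv 𝕜 g l x u) =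
      -(D 1 (x, g x) (fun _ => (idDeriv l u, 0)) +
        ∑ c ∈ Finset.univ.erase (oneBlock l hl0), D c.length (x, g x) (fun m =>
          (idDeriv (c.partSize m.rev) fun r => u (c.emb m.rev r),
            plotDeriv 𝕜 g (c.partSize m.rev) x fun r => u (c.emb m.rev r)))) := by
  have hsum := h.sum_partitions_eq_zero hΩ hgk hb hl0 hl hx u
  rw [← Finset.add_sum_erase _ _ (Finset.mem_univ (oneBlock l hl0))] at hsum
  have hone : D 1 (x, g x) (fun _ => (idDeriv l u, plotDeriv 𝕜 g l x u)) =
      D 1 (x, g x) (fun _ => (idDeriv l u, 0)) +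
        partialDeriv₂ D (x, g x) (plotDeriv 𝕜 g l x u) := by
    have e : ∀ v : E × G, (fun _ : Fin 1 => v) = Function.update (fun _ => 0) 0 v := fun v => by
      funext i
      rw [Subsingleton.elim i 0, Function.update_self]
    rw [partialDeriv₂_apply, e, e (_, 0), e (0, _), ← ContinuousMultilinearMap.map_update_add]
    simp
  have hblock : D (oneBlock l hl0).length (x, g x) (fun m =>
      (idDeriv ((oneBlock l hl0).partSize m.rev) fun r => u ((oneBlock l hl0).emb m.rev r),
        plotDeriv 𝕜 g ((oneBlock l hl0).partSize m.rev) x fun r =>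
          u ((oneBlock l hl0).emb m.rev r))) =
      D 1 (x, g x) (fun _ => (idDeriv l u, plotDeriv 𝕜 g l x u)) := rfl
  rw [hblock, hone] at hsum
  refine eq_neg_of_add_eq_zero_left (Eq.trans ?_ hsum)
  abel

/-- Strong induction through `partialDeriv₂_plotDeriv`: its right side is uniform by
`comp_multilinear`, and the inverse of `∂₂` depends continuously on `x` in operator norm. The same
seminorm serves all orders up to `l`. -/
theorem uniformAt_plotDeriv_of_seminorm (h : IsKellerJet k f D) (hk : 1 ≤ k) (hΩ : IsOpen Ω)
    (hg : ContinuousOn g Ω) (hb : ∀ x ∈ Ω, b ∈ f (x, g x))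
    (hbij : ∀ x ∈ Ω, Function.Bijective (partialDeriv₂ D (x, g x))) {x : E} (hx : x ∈ Ω)
    {p : Seminorm 𝕜 (E × G)} (hp : Continuous p) {l : ℕ} (hl : (l : ℕ∞) ≤ k)
    (hD : ∀ m ≤ l, UniformAt p (normSeminorm 𝕜 G) (fun z u => D m z u) (x, g x)) :
    UniformAt (p.comp (LinearMap.inl 𝕜 E G)) (normSeminorm 𝕜 G) (plotDeriv 𝕜 g l) x := by
  classical
  induction l using Nat.strong_induction_on with
  | _ l ih =>
  have hgx : ContinuousAt g x := hg.continuousAt (hΩ.mem_nhds hx)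
  have hgraph : ContinuousAt (fun x => (x, g x)) x := continuousAt_id.prodMk hgx
  rcases Nat.eq_zero_or_pos l with rfl | hl0
  · refine ⟨⟨‖g x‖, fun u _ => by rw [plotDeriv_zero]; rfl⟩, fun ε hε => ?_⟩
    filter_upwards [Metric.continuousAt_iff'.1 hgx ε hε] with x' hx' u _
    rw [plotDeriv_zero, plotDeriv_zero, coe_normSeminorm, ← dist_eq_norm]
    exact hx'.le
  have hgk := h.plotContDiffOn_implicit hk hΩ hg hb hbij
  have hDg : ∀ m ≤ l, UniformAt p (normSeminorm 𝕜 G) (fun x u => D m (x, g x) u) x :=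
    fun m hm => (hD m hm).comp_continuousAt (φ := fun x => (x, g x)) hgraph
  have hpair : ∀ m < l, UniformAt (p.comp (LinearMap.inl 𝕜 E G)) p
      (fun x u => (idDeriv m u, plotDeriv 𝕜 g m x u)) x := fun m hm =>
    (ih m hm (le_trans (by exact_mod_cast hm.le) hl) fun m' hm' => hD m' (hm'.trans hm.le)).pair hp
  have hfirst : UniformAt (p.comp (LinearMap.inl 𝕜 E G)) (normSeminorm 𝕜 G)
      (fun x u => D 1 (x, g x) (fun _ => (idDeriv l u, 0))) x :=
    UniformAt.comp_multilinear (Q := fun x => (D 1 (x, g x)).toMultilinearMap) (hDg 1 hl0)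
      (n := fun _ => l) (R := fun _ _ u => (idDeriv l u, 0)) (fun _ => UniformAt.zero.pair hp)
      fun _ r => r
  have hrest : UniformAt (p.comp (LinearMap.inl 𝕜 E G)) (normSeminorm 𝕜 G)
      (fun x u => ∑ c ∈ Finset.univ.erase (oneBlock l hl0), D c.length (x, g x) (fun m =>
          (idDeriv (c.partSize m.rev) fun r => u (c.emb m.rev r),
            plotDeriv 𝕜 g (c.partSize m.rev) x fun r => u (c.emb m.rev r)))) x := by
    refine UniformAt.sum _ fun c hc => ?_
    exact UniformAt.comp_multilinear (Q := fun x => (D c.length (x, g x)).toMultilinearMap)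
      (hDg _ c.length_le) (n := fun m => c.partSize m.rev)
      (R := fun m x u => (idDeriv (c.partSize m.rev) u, plotDeriv 𝕜 g (c.partSize m.rev) x u))
      (fun m => hpair _ (partSize_lt_of_ne_oneBlock hl0 (Finset.ne_of_mem_erase hc) m.rev))
      fun m r => c.emb m.rev r
  have hinvx := isInvertible_of_bijective (hbij x hx)
  have hcinv : ContinuousAt (fun x => (partialDeriv₂ D (x, g x)).inverse) x :=
    ContinuousAt.comp (f := fun x => partialDeriv₂ D (x, g x))
      (hinvx.contDiffAt_map_inverse (n := 0)).continuousAt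
      (ContinuousAt.comp (f := fun x => (x, g x))
        (h.continuousAt_partialDeriv₂ hk (Part.dom_iff_mem.2 ⟨b, hb x hx⟩)) hgraph)
  refine (UniformAt.clm_apply hcinv (hfirst.add hrest).neg).congr ?_
  filter_upwards [hΩ.mem_nhds hx] with x' hx'
  funext u
  rw [(isInvertible_of_bijective (hbij x' hx')).inverse_apply_eq]
  exact (h.partialDeriv₂_plotDeriv hΩ hgk hb hl0 hl hx' u).symm

theorem exists_seminorm_uniformAt_plotDeriv [Module ℝ E] [IsScalarTower ℝ 𝕜 E]
    [LocallyConvexSpace ℝ E] (h : IsKellerJet k f D) (hk : 1 ≤ k) (hΩ : IsOpen Ω)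
    (hg : ContinuousOn g Ω) (hb : ∀ x ∈ Ω, b ∈ f (x, g x))
    (hbij : ∀ x ∈ Ω, Function.Bijective (partialDeriv₂ D (x, g x))) {x : E} (hx : x ∈ Ω)
    {l : ℕ} (hl : (l : ℕ∞) ≤ k) :
    ∃ q : Seminorm 𝕜 E, Continuous q ∧ UniformAt q (normSeminorm 𝕜 G) (plotDeriv 𝕜 g l) x := by
  obtain ⟨p, hp, hD⟩ := h.exists_seminorm_forall_uniformAt
    (fun U hU => exists_continuous_seminorm_of_mem_nhds_prod hU) hl
    (Part.dom_iff_mem.2 ⟨b, hb x hx⟩)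
  exact ⟨p.comp (LinearMap.inl 𝕜 E G), hp.comp (by fun_prop : Continuous fun v : E => (v, (0 : G))),
    h.uniformAt_plotDeriv_of_seminorm hk hΩ hg hb hbij hx hp hl hD⟩

end IsKellerJet

end ImplicitSmooth

/-! ### The implicit function theorem in one Banach space. -/

section ImplicitFunction

variable {𝕜 : Type*} [RCLike 𝕜]
  {E : Type*} [AddCommGroup E] [Module 𝕜 E] [TopologicalSpace E] [IsTopologicalAddGroup E]
  [ContinuousSMul 𝕜 E]
  {G : Type*} [NormedAddCommGroup G] [NormedSpace 𝕜 G]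
  {k : ℕ∞} {f : E × G →. G}
  {D : ∀ l : ℕ, E × G → ContinuousMultilinearMap 𝕜 (fun _ : Fin l => E × G) G}

theorem exists_isOpen_balanced_translate {x₀ : E} {V : Set E} (hV : V ∈ 𝓝 x₀) :
    ∃ N ⊆ V, IsOpen N ∧ x₀ ∈ N ∧
      ∀ x ∈ N, ∀ t : 𝕜, ‖t‖ ≤ 1 → (1 - t) • x₀ + t • x ∈ N := by
  have hV' : (fun v => x₀ + v) ⁻¹' V ∈ 𝓝 (0 : E) :=
    (by fun_prop : Continuous fun v => x₀ + v).continuousAt (by simpa using hV)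
  set b := balancedCore 𝕜 ((fun v => x₀ + v) ⁻¹' V)
  have hb : b ∈ 𝓝 (0 : E) := balancedCore_mem_nhds_zero hV'
  have hbal : Balanced 𝕜 (interior b) :=
    (balancedCore_balanced _).interior (mem_interior_iff_mem_nhds.2 hb)
  refine ⟨(fun x => x - x₀) ⁻¹' interior b, fun x hx => ?_,
    isOpen_interior.preimage (by fun_prop), ?_, fun x hx t ht => ?_⟩
  · simpa using balancedCore_subset _ (interior_subset hx)
  · simpa using mem_interior_iff_mem_nhds.2 hb
  · have e : (1 - t) • x₀ + t • x - x₀ = t • (x - x₀) := by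
      rw [sub_smul, one_smul, smul_sub]
      abel
    change _ - x₀ ∈ interior b
    rw [e]
    exact hbal.smul_mem ht hx

namespace IsKellerJet

theorem hasFDerivAt_snd (h : IsKellerJet k f D) (hk : 1 ≤ k) {x : E} {y : G}
    (hxy : (x, y) ∈ f.Dom) :
    HasFDerivAt (fun y => D 0 (x, y) 0) (partialDeriv₂ D (x, y)) y := by
  set M := ContinuousLinearMap.inr 𝕜 E G with hM
  have hMy : ∀ y, (x, (0 : G)) + M y = (x, y) := fun y => by simp [hM]
  have hdom : (x, (0 : G)) + M y ∈ f.Dom := by rwa [hMy]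
  have h1 : HasFDerivAt (fun y => D 0 ((x, 0) + M y) 0) _ y :=
    ((h.contDiffAt (x, 0) M hdom).differentiableAt (by
      intro h0
      have : k = 0 := by exact_mod_cast h0
      simp [this] at hk)).hasFDerivAt
  have h2 : fderiv 𝕜 (fun y => D 0 ((x, 0) + M y) 0) y = partialDeriv₂ D (x, y) := by
    ext v
    have := h.iteratedFDeriv_apply (x, 0) M hdom (l := 1) (by exact_mod_cast hk) fun _ => v
    rw [iteratedFDeriv_one_apply, hMy] at this
    rw [this, partialDeriv₂_apply]
    rfl
  rw [h2] at h1
  simpa only [hMy] using h1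

/-- The implicit function theorem without differentiability of the implicit function. -/
theorem exists_implicit [CompleteSpace G] (h : IsKellerJet k f D) (hk : 1 ≤ k) {x₀ : E} {y₀ b : G}
    (hb : b ∈ f (x₀, y₀)) (hbij : Function.Bijective (partialDeriv₂ D (x₀, y₀)))
    {O : Set (E × G)} (hO : O ∈ 𝓝 (x₀, y₀)) :
    ∃ (N : Set E) (r : ℝ) (g : E → G), IsOpen N ∧ x₀ ∈ N ∧
      (∀ x ∈ N, ∀ t : 𝕜, ‖t‖ ≤ 1 → (1 - t) • x₀ + t • x ∈ N) ∧ 0 < r ∧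
      (∀ x ∈ N, ∀ y ∈ Metric.ball y₀ r, (x, y) ∈ O) ∧
      (∀ x ∈ N, g x ∈ Metric.ball y₀ r ∧ b ∈ f (x, g x) ∧
        Function.Bijective (partialDeriv₂ D (x, g x))) ∧
      (∀ x ∈ N, ∀ y ∈ Metric.ball y₀ r, b ∈ f (x, y) → y = g x) ∧ ContinuousOn g N := by
  let : NormedSpace ℝ G := NormedSpace.restrictScalars ℝ 𝕜 G
  have hdom₀ : (x₀, y₀) ∈ f.Dom := Part.dom_iff_mem.2 ⟨b, hb⟩
  obtain ⟨A, hA⟩ := isInvertible_of_bijective hbij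
  set K : ℝ := ‖(A.symm : G →L[𝕜] G)‖ + 1 with hK
  have hK0 : 0 < K := by positivity
  have hAK : ∀ v : G, ‖v‖ ≤ K * ‖A v‖ := fun v => by
    have := (A.symm : G →L[𝕜] G).le_opNorm (A v)
    simp only [ContinuousLinearEquiv.coe_coe, ContinuousLinearEquiv.symm_apply_apply] at this
    refine this.trans (mul_le_mul_of_nonneg_right ?_ (norm_nonneg _))
    rw [hK]
    linarith
  -- If `D 0 (x, ·) 0` differs from `A` by a `c`-Lipschitz map, it expands distances by at least `1
  -- / (2 * K)` and covers balls with factor `K⁻¹ - c = c`.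
  set c : ℝ := K⁻¹ / 2 with hc
  have hc0 : 0 < c := by positivity
  have hcont := h.continuousAt_partialDeriv₂ hk hdom₀
  have hinv : ∀ᶠ z in 𝓝 (x₀, y₀), Function.Bijective (partialDeriv₂ D z) := by
    have h1 := A.nhds
    rw [hA] at h1
    filter_upwards [hcont h1] with z hz
    obtain ⟨A', hA'⟩ := hz
    have := A'.bijective
    rwa [← ContinuousLinearEquiv.coe_coe, hA'] at this
  have hgood : ∀ᶠ z in 𝓝 (x₀, y₀), (z ∈ O ∧ z ∈ f.Dom) ∧
      Function.Bijective (partialDeriv₂ D z) ∧ ‖partialDeriv₂ D z - A‖ ≤ c := by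
    refine ((eventually_mem_set.2 hO).and (h.isOpen_dom.mem_nhds hdom₀)).and (hinv.and ?_)
    filter_upwards [Metric.continuousAt_iff'.1 hcont c hc0] with z hz
    rw [hA, ← dist_eq_norm]
    exact hz.le
  obtain ⟨V, hV, V', hV', hVV⟩ := mem_nhds_prod_iff.1 hgood
  obtain ⟨r, hr, hrV⟩ := Metric.mem_nhds_iff.1 hV'
  have hgood' : ∀ x ∈ V, ∀ y ∈ Metric.ball y₀ r, _ := fun x hx y hy =>
    hVV (Set.mk_mem_prod hx (hrV hy))
  have happrox : ∀ x ∈ V, ApproximatesLinearOn (fun y => D 0 (x, y) 0) (A : G →L[𝕜] G)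
      (Metric.ball y₀ r) ⟨c, hc0.le⟩ := fun x hx y hy y' hy' =>
    (convex_ball y₀ r).norm_image_sub_le_of_norm_hasFDerivWithin_le'
      (fun w hw => (h.hasFDerivAt_snd hk (hgood' x hx w hw).1.2).hasFDerivWithinAt)
      (fun w hw => (hgood' x hx w hw).2.2) hy' hy
  have hanti : ∀ x ∈ V, ∀ y ∈ Metric.ball y₀ r, ∀ y' ∈ Metric.ball y₀ r,
      ‖y - y'‖ ≤ 2 * K * ‖D 0 (x, y) 0 - D 0 (x, y') 0‖ := by
    intro x hx y hy y' hy'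
    have h1 : ‖D 0 (x, y) 0 - D 0 (x, y') 0 - A (y - y')‖ ≤ c * ‖y - y'‖ :=
      happrox x hx y hy y' hy'
    have h2 := hAK (y - y')
    have h3 : ‖A (y - y')‖ ≤ ‖D 0 (x, y) 0 - D 0 (x, y') 0‖ + c * ‖y - y'‖ := by
      have := norm_sub_le (D 0 (x, y) 0 - D 0 (x, y') 0)
        (D 0 (x, y) 0 - D 0 (x, y') 0 - A (y - y'))
      rw [sub_sub_cancel] at this
      linarith
    have h4 : K * (c * ‖y - y'‖) = ‖y - y'‖ / 2 := by
      rw [hc]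
      field_simp
    nlinarith [mul_le_mul_of_nonneg_left h3 hK0.le]
  let R : (A : G →L[𝕜] G).NonlinearRightInverse :=
    { toFun := A.symm
      nnnorm := ⟨K, hK0.le⟩
      bound' := fun y => by
        have := hAK (A.symm y)
        rwa [A.apply_symm_apply] at this
      right_inv' := A.apply_symm_apply }
  have hsurj : ∀ x ∈ V, Set.SurjOn (fun y => D 0 (x, y) 0) (Metric.closedBall y₀ (r / 2))
      (Metric.closedBall (D 0 (x, y₀) 0) (c * (r / 2))) := by
    intro x hx
    have := (happrox x hx).surjOn_closedBall_of_nonlinearRightInverse R (by positivity : 0 ≤ r / 2)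
      (Metric.closedBall_subset_ball (by linarith))
    have e : ((R.nnnorm : ℝ)⁻¹ - c) = c := by
      change K⁻¹ - c = c
      rw [hc]
      ring
    change Set.SurjOn _ _ (Metric.closedBall _ (((R.nnnorm : ℝ)⁻¹ - c) * (r / 2))) at this
    rwa [e] at this
  -- For `x` near `x₀` the value `b` lies in the ball known to be covered.
  have hclose : ∀ᶠ x in 𝓝 x₀, D 0 (x₀, y₀) 0 ∈ Metric.closedBall (D 0 (x, y₀) 0) (c * (r / 2)) := by
    have hcx : ContinuousAt (fun x => D 0 (x, y₀) 0) x₀ :=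
      ContinuousAt.comp (f := fun x => (x, y₀)) (h.continuousAt_apply hdom₀) (by fun_prop)
    filter_upwards [Metric.continuousAt_iff'.1 hcx (c * (r / 2)) (by positivity)] with x hx
    rw [Metric.mem_closedBall, dist_comm]
    exact hx.le
  obtain ⟨N, hNV, hN, hx₀, hNbal⟩ := exists_isOpen_balanced_translate (𝕜 := 𝕜)
    (inter_mem hV hclose)
  have hex : ∀ x : E, ∃ y, x ∈ N → y ∈ Metric.ball y₀ r ∧ D 0 (x, y) 0 = b := by
    intro x
    by_cases hx : x ∈ N
    · obtain ⟨y, hy, hyb⟩ := hsurj x (hNV hx).1 (hNV hx).2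
      exact ⟨y, fun _ => ⟨Metric.closedBall_subset_ball (by linarith) hy,
        hyb.trans (h.apply_eq hb)⟩⟩
    · exact ⟨0, fun h => absurd h hx⟩
  choose g hg using hex
  have hVdom : ∀ x ∈ N, ∀ y ∈ Metric.ball y₀ r, (x, y) ∈ f.Dom := fun x hx y hy =>
    (hgood' x (hNV hx).1 y hy).1.2
  refine ⟨N, r, g, hN, hx₀, hNbal, hr, fun x hx y hy => (hgood' x (hNV hx).1 y hy).1.1,
    fun x hx => ⟨(hg x hx).1, ?_, (hgood' x (hNV hx).1 _ (hg x hx).1).2.1⟩, ?_, ?_⟩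
  · have := h.mem_apply (hVdom x hx _ (hg x hx).1)
    rwa [(hg x hx).2] at this
  · intro x hx y hy hby
    have := hanti x (hNV hx).1 y hy (g x) (hg x hx).1
    rw [h.apply_eq hby, (hg x hx).2, sub_self, norm_zero, mul_zero] at this
    exact sub_eq_zero.1 (norm_le_zero_iff.1 this)
  · intro x hx
    refine ContinuousAt.continuousWithinAt ?_
    have hcx : ContinuousAt (fun x' => D 0 (x', g x) 0) x :=
      ContinuousAt.comp (f := fun x' => (x', g x))
        (h.continuousAt_apply (hVdom x hx _ (hg x hx).1)) (by fun_prop)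
    -- `hanti` bounds `‖g x' - g x‖` by `2 * K` times the defect of the old solution `g x` at the
    -- new parameter `x'`.
    rw [ContinuousAt, tendsto_iff_norm_sub_tendsto_zero] at hcx ⊢
    have hlim := hcx.const_mul (2 * K)
    rw [mul_zero] at hlim
    refine squeeze_zero' (Eventually.of_forall fun _ => norm_nonneg _) ?_ hlim
    filter_upwards [hN.mem_nhds hx] with x' hx'
    have := hanti x' (hNV hx').1 (g x') (hg x' hx').1 (g x) (hg x hx).1
    rwa [(hg x' hx').2, ← (hg x hx).2, norm_sub_rev (D 0 (x, g x) 0)] at this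

end IsKellerJet

end ImplicitFunction

/-! ### Concrete consequences of the universal property. -/

section ProjectiveLimits

variable {𝕜 : Type uK} [RCLike 𝕜] {ι : Type uI} [Preorder ι]
  {G : ι → Type uG} [∀ i, NormedAddCommGroup (G i)] [∀ i, NormedSpace 𝕜 (G i)]
  {F : Type uF} [AddCommGroup F] [Module 𝕜 F] [Module ℝ F] [IsScalarTower ℝ 𝕜 F]
  [TopologicalSpace F] [IsTopologicalAddGroup F] [ContinuousSMul 𝕜 F] [LocallyConvexSpace ℝ F]
  [T2Space F]
  {ρ : ∀ i j : ι, i ≤ j → G j →L[𝕜] G i} {p : ∀ i, F →L[𝕜] G i}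

/-- The space of compatible families of a projective system. -/
def compatibleFamilies (ρ : ∀ i j : ι, i ≤ j → G j →L[𝕜] G i) : Submodule 𝕜 (∀ i, G i) where
  carrier := {y | ∀ (i j : ι) (hij : i ≤ j), ρ i j hij (y j) = y i}
  add_mem' ha hb i j hij := by simp [ha i j hij, hb i j hij]
  zero_mem' i j hij := by simp
  smul_mem' c a ha i j hij := by simp [ha i j hij]

section ULift

variable (𝕜) (X : Type*) [AddCommGroup X] [Module 𝕜 X] [TopologicalSpace X]

/-- The canonical isomorphism between a space and its lift to a larger universe. -/
def uliftEquiv : ULift.{uE} X ≃L[𝕜] X where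
  toLinearEquiv := ULift.moduleEquiv
  continuous_toFun := continuous_uliftDown
  continuous_invFun := continuous_uliftUp

end ULift

/-- A point of `F` is a linear map `𝕜 → F`; the uniqueness clause, tested on a lift of `𝕜`,
separates points. -/
theorem eq_of_forall_apply_eq (h : IsProjectiveLimit 𝕜 ρ p) {y y' : F}
    (hy : ∀ i, p i y = p i y') : y = y' := by
  let ℓ : F → (ULift.{max uF uI uG} 𝕜 →L[𝕜] F) := fun y =>
    (ContinuousLinearMap.toSpanSingleton 𝕜 y).comp
      (uliftEquiv 𝕜 𝕜 : ULift.{max uF uI uG} 𝕜 →L[𝕜] 𝕜)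
  have hcone : IsCone 𝕜 ρ fun i => (p i).comp (ℓ y) := fun i j hij => by
    rw [← ContinuousLinearMap.comp_assoc, ← h.2.2.1 i j hij]
  have huniq := (h.2.2.2 (ULift.{max uF uI uG} 𝕜) _ hcone).unique (y₁ := ℓ y)
    (y₂ := ℓ y') (fun i => rfl) fun i => by
    ext t
    change p i (t.down • y) = p i (t.down • y')
    rw [map_smul, map_smul, hy]
  have := congrArg (fun m : ULift.{max uF uI uG} 𝕜 →L[𝕜] F => m ⟨1⟩) huniq
  change (1 : 𝕜) • y = (1 : 𝕜) • y' at this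
  simpa using this

/-- The projective limit is a quotient of the space of compatible families. -/
theorem exists_lift_compatibleFamilies (h : IsProjectiveLimit 𝕜 ρ p) :
    ∃ ℓ : compatibleFamilies ρ →L[𝕜] F, ∀ i y, p i (ℓ y) = y.1 i := by
  let : ∀ i, NormedSpace ℝ (G i) := fun i => NormedSpace.restrictScalars ℝ 𝕜 (G i)
  have : ∀ i, IsScalarTower ℝ 𝕜 (G i) := fun i =>
    IsScalarTower.of_algebraMap_smul fun _ _ => rfl
  have : IsTopologicalAddGroup (ULift.{max uK uF} (compatibleFamilies ρ)) :=
    { continuous_add := continuous_uliftUp.comp (by fun_prop)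
      continuous_neg := continuous_uliftUp.comp (by fun_prop) }
  have : ContinuousSMul 𝕜 (ULift.{max uK uF} (compatibleFamilies ρ)) :=
    ⟨continuous_uliftUp.comp (by fun_prop)⟩
  have : LocallyConvexSpace ℝ (compatibleFamilies ρ) :=
    IsInducing.subtypeVal.locallyConvexSpace
      (f := (compatibleFamilies ρ).subtype.restrictScalars ℝ)
  have : LocallyConvexSpace ℝ (ULift.{max uK uF} (compatibleFamilies ρ)) :=
    (uliftEquiv ℝ (compatibleFamilies ρ)).toHomeomorph.isInducing.locallyConvexSpace
  let e : ULift.{max uK uF} (compatibleFamilies ρ) ≃L[𝕜] compatibleFamilies ρ := uliftEquiv 𝕜 _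
  let q : ∀ i, ULift.{max uK uF} (compatibleFamilies ρ) →L[𝕜] G i := fun i =>
    ((ContinuousLinearMap.proj i).comp (compatibleFamilies ρ).subtypeL).comp e.toContinuousLinearMap
  have hcone : IsCone 𝕜 ρ q := fun i j hij => by
    ext y
    exact (y.down.2 i j hij).symm
  obtain ⟨ℓ, hℓ, -⟩ := h.2.2.2 (ULift.{max uK uF} (compatibleFamilies ρ)) q hcone
  refine ⟨ℓ.comp e.symm.toContinuousLinearMap, fun i y => ?_⟩
  exact (DFunLike.congr_fun (hℓ i) (e.symm y)).symm

/-- The map `ℓ` from compatible families is continuous for the product topology and inverts `y ↦ (p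
i y)`, so convergence in `F` is componentwise. -/
theorem tendsto_of_forall_tendsto_apply (h : IsProjectiveLimit 𝕜 ρ p) {X : Type*} {l : Filter X}
    {g : X → F} {y : F} (hg : ∀ i, Tendsto (fun x => p i (g x)) l (𝓝 (p i y))) :
    Tendsto g l (𝓝 y) := by
  obtain ⟨ℓ, hℓ⟩ := exists_lift_compatibleFamilies h
  let P : F → compatibleFamilies ρ := fun y =>
    ⟨fun i => p i y, fun i j hij => (DFunLike.congr_fun (h.2.2.1 i j hij) y).symm⟩
  have hP : ∀ y, ℓ (P y) = y := fun y => eq_of_forall_apply_eq h fun i => hℓ i (P y)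
  have h1 : Tendsto (fun x => P (g x)) l (𝓝 (P y)) :=
    tendsto_subtype_rng.2 (tendsto_pi_nhds.2 hg)
  have h2 := (ℓ.continuous.tendsto (P y)).comp h1
  simpa only [hP, Function.comp_def] using h2

section Cofinal

variable {i₀ : ι}

theorem eq_of_forall_ge_apply_eq (h : IsProjectiveLimit 𝕜 ρ p) {y y' : F}
    (hy : ∀ j, i₀ ≤ j → p j y = p j y') : y = y' :=
  eq_of_forall_apply_eq h fun i => by
    obtain ⟨j, hij, hj⟩ := h.1.directed i i₀
    rw [h.2.2.1 i j hij, ContinuousLinearMap.comp_apply, ContinuousLinearMap.comp_apply, hy j hj]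

theorem tendsto_of_forall_ge_tendsto_apply (h : IsProjectiveLimit 𝕜 ρ p) {X : Type*}
    {l : Filter X} {g : X → F} {y : F}
    (hg : ∀ j, i₀ ≤ j → Tendsto (fun x => p j (g x)) l (𝓝 (p j y))) : Tendsto g l (𝓝 y) :=
  tendsto_of_forall_tendsto_apply h fun i => by
    obtain ⟨j, hij, hj⟩ := h.1.directed i i₀
    rw [h.2.2.1 i j hij]
    exact ((ρ i j hij).continuous.tendsto _).comp (hg j hj)

/-- A family given above `i₀` extends to every `i` by pushing down from some `k i` above `i` and
`i₀`; directedness removes the dependence on the choice. -/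
theorem exists_apply_eq_of_compatible (h : IsProjectiveLimit 𝕜 ρ p) (y : ∀ j, i₀ ≤ j → G j)
    (hy : ∀ (i j : ι) (hi : i₀ ≤ i) (hij : i ≤ j), ρ i j hij (y j (hi.trans hij)) = y i hi) :
    ∃ z : F, ∀ j hj, p j z = y j hj := by
  obtain ⟨ℓ, hℓ⟩ := exists_lift_compatibleFamilies h
  choose k hk hk₀ using fun i => h.1.directed i i₀
  have key : ∀ (i j : ι) (hij : i ≤ j) (hj : i₀ ≤ j),
      ρ i j hij (y j hj) = ρ i (k i) (hk i) (y (k i) (hk₀ i)) := by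
    intro i j hij hj
    obtain ⟨m, hjm, hkm⟩ := h.1.directed j (k i)
    rw [← hy j m hj hjm, ← hy (k i) m (hk₀ i) hkm, h.1.map_map, h.1.map_map]
  refine ⟨ℓ ⟨fun i => ρ i (k i) (hk i) (y (k i) (hk₀ i)), fun i j hij => ?_⟩, fun j hj => ?_⟩
  · rw [h.1.map_map]
    exact key i (k j) _ (hk₀ j)
  · rw [hℓ]
    exact hy j (k j) hj (hk j)

/-- A product neighbourhood restricts finitely many coordinates, and one index `j` dominates them
all. -/
theorem exists_preimage_ball_subset (h : IsProjectiveLimit 𝕜 ρ p) {W : Set F}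
    (hW : W ∈ 𝓝 (0 : F)) :
    ∃ j, i₀ ≤ j ∧ ∃ r : ℝ, 0 < r ∧ ∀ y, ‖p j y‖ ≤ r → y ∈ W := by
  obtain ⟨ℓ, hℓ⟩ := exists_lift_compatibleFamilies h
  let P : F → compatibleFamilies ρ := fun y =>
    ⟨fun i => p i y, fun i j hij => (DFunLike.congr_fun (h.2.2.1 i j hij) y).symm⟩
  have hP : ∀ y, ℓ (P y) = y := fun y => eq_of_forall_apply_eq h fun i => hℓ i (P y)
  have hℓW : ℓ ⁻¹' W ∈ 𝓝 (0 : compatibleFamilies ρ) :=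
    ℓ.continuous.continuousAt (by rwa [map_zero])
  rw [nhds_subtype_eq_comap] at hℓW
  obtain ⟨V, hV, hVW⟩ := hℓW
  change V ∈ 𝓝 (0 : ∀ i, G i) at hV
  rw [nhds_pi] at hV
  obtain ⟨I, hI, t, ht, htI⟩ := Filter.mem_pi.1 hV
  have : IsDirectedOrder ι := ⟨h.1.directed⟩
  have : Nonempty ι := h.2.1
  obtain ⟨m, hm⟩ := hI.bddAbove
  obtain ⟨j, hmj, hj⟩ := h.1.directed m i₀
  have hIj : ∀ i ∈ I, i ≤ j := fun i hi => (hm hi).trans hmj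
  have hU : {v : G j | ∀ i (hi : i ∈ I), ρ i j (hIj i hi) v ∈ t i} ∈ 𝓝 (0 : G j) := by
    have hfin := hI.to_subtype
    have : ∀ᶠ v in 𝓝 (0 : G j), ∀ i : I, ρ i.1 j (hIj i.1 i.2) v ∈ t i.1 :=
      eventually_all.2 fun i => (ρ i.1 j _).continuous.continuousAt (by
        rw [map_zero]
        exact ht i.1)
    filter_upwards [this] with v hv i hi using hv ⟨i, hi⟩
  obtain ⟨r, hr, hrU⟩ := Metric.nhds_basis_closedBall.mem_iff.1 hU
  refine ⟨j, hj, r, hr, fun y hy => ?_⟩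
  rw [← hP y]
  refine hVW (htI fun i hi => ?_)
  have := hrU (by simpa using hy : p j y ∈ Metric.closedBall 0 r) i hi
  change p i y ∈ t i
  rwa [h.2.2.1 i j (hIj i hi)]

end Cofinal

end ProjectiveLimits

/-! ### Componentwise criterion for `C^k_Π`. -/

section Assembly

variable {𝕜 : Type uK} [RCLike 𝕜] {ι : Type uI} [Preorder ι]
  {G : ι → Type uG} [∀ i, NormedAddCommGroup (G i)] [∀ i, NormedSpace 𝕜 (G i)]
  {E : Type uE} [AddCommGroup E] [Module 𝕜 E] [TopologicalSpace E] [IsTopologicalAddGroup E]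
  [ContinuousSMul 𝕜 E]
  {F : Type uF} [AddCommGroup F] [Module 𝕜 F] [Module ℝ F] [IsScalarTower ℝ 𝕜 F]
  [TopologicalSpace F] [IsTopologicalAddGroup F] [ContinuousSMul 𝕜 F] [LocallyConvexSpace ℝ F]
  [T2Space F]
  {ρ : ∀ i j : ι, i ≤ j → G j →L[𝕜] G i} {p : ∀ i, F →L[𝕜] G i}

theorem PlotContDiffOn.plotDeriv_clm_comp {B C : Type*} [NormedAddCommGroup B] [NormedSpace 𝕜 B]
    [NormedAddCommGroup C] [NormedSpace 𝕜 C] {k : ℕ∞} {g : E → B} {Ω : Set E}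
    (hg : PlotContDiffOn 𝕜 k g Ω) (L : B →L[𝕜] C) {l : ℕ} (hl : (l : ℕ∞) ≤ k) {x : E} (hx : x ∈ Ω)
    (u : Fin l → E) :
    plotDeriv 𝕜 (fun x => L (g x)) l x u = L (plotDeriv 𝕜 g l x u) := by
  have h1 := L.iteratedFDeriv_comp_left (hg l (combination u) x 0 (by simpa using hx))
    (i := l) (by exact_mod_cast hl)
  exact DFunLike.congr_fun h1 fun i => Pi.single i 1

/-- A map to a projective limit of Banach spaces is of class `C^k_Π` if its components are. -/
theorem isKellerC_of_forall_component (h : IsProjectiveLimit 𝕜 ρ p) {i₀ : ι} {k : ℕ∞} {N : Set E}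
    (hN : IsOpen N) {g : E → F}
    (hg : ∀ j, i₀ ≤ j → PlotContDiffOn 𝕜 k (fun x => p j (g x)) N)
    (hu : ∀ j, i₀ ≤ j → ∀ x ∈ N, ∀ l : ℕ, (l : ℕ∞) ≤ k → ∃ q : Seminorm 𝕜 E, Continuous q ∧
      UniformAt q (normSeminorm 𝕜 (G j)) (plotDeriv 𝕜 (fun x => p j (g x)) l) x) :
    IsKellerC 𝕜 k (fun x => ⟨x ∈ N, fun _ => g x⟩ : E →. F) := by
  classical
  -- The componentwise derivatives commute with the connecting maps, hence come from one element of
  -- `F`.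
  have hex : ∀ (l : ℕ) (x : E) (u : Fin l → E), ∃ z : F, (l : ℕ∞) ≤ k → x ∈ N →
      ∀ j, i₀ ≤ j → p j z = plotDeriv 𝕜 (fun x => p j (g x)) l x u := by
    intro l x u
    by_cases hlx : (l : ℕ∞) ≤ k ∧ x ∈ N
    · obtain ⟨z, hz⟩ := exists_apply_eq_of_compatible h (i₀ := i₀)
        (fun j _ => plotDeriv 𝕜 (fun x => p j (g x)) l x u) fun i j hi hij => by
          rw [← (hg j (hi.trans hij)).plotDeriv_clm_comp (ρ i j hij) hlx.1 hlx.2 u, h.2.2.1 i j hij]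
          rfl
      exact ⟨z, fun _ _ => hz⟩
    · exact ⟨0, fun h1 h2 => absurd ⟨h1, h2⟩ hlx⟩
  choose H hH using hex
  refine ⟨hN, fun l hl => ?_⟩
  let M : ∀ x ∈ N, ContinuousMultilinearMap 𝕜 (fun _ : Fin l => E) F := fun x hx =>
    { toFun := H l x
      map_update_add' := fun u i a b => by
        refine eq_of_forall_ge_apply_eq h (i₀ := i₀) fun j hj => ?_
        rw [map_add, hH l x _ hl hx j hj, hH l x _ hl hx j hj, hH l x _ hl hx j hj]
        convert! (hg j hj).plotDeriv_update_add hl hx u i a b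
      map_update_smul' := fun u i c a => by
        refine eq_of_forall_ge_apply_eq h (i₀ := i₀) fun j hj => ?_
        rw [map_smul, hH l x _ hl hx j hj, hH l x _ hl hx j hj]
        convert! (hg j hj).plotDeriv_update_smul hl hx u i c a
      cont := continuous_iff_continuousAt.2 fun u =>
        tendsto_of_forall_ge_tendsto_apply h (i₀ := i₀) fun j hj => by
          obtain ⟨q, hq, ⟨C, hC⟩, -⟩ := hu j hj x hx l hl
          have := continuous_of_bounded ((hg j hj).plotDerivMultilinear hl hx) hq hC
          simp only [hH l x _ hl hx j hj]
          exact this.tendsto u }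
  let D : E → ContinuousMultilinearMap 𝕜 (fun _ : Fin l => E) F := fun x =>
    if hx : x ∈ N then (M x hx).domDomCongr Fin.revPerm else 0
  have hD : ∀ x ∈ N, ∀ u, D x u = H l x fun i => u i.rev := fun x hx u => by
    simp only [D, dif_pos hx]
    rfl
  refine ⟨D, fun x hx u => ?_, fun x hx W hW => ?_⟩
  · rw [hD x hx]
    refine mem_iterDirDeriv_of_tendsto hN (k := k) (H := fun l x u => H l x fun i => u i.rev)
      (fun x hx u => ?_) (fun l hl x hx u => ?_) l hl x hx u
    · refine ⟨hx, eq_of_forall_ge_apply_eq h (i₀ := i₀) fun j hj => ?_⟩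
      rw [hH 0 x _ (by simp) hx j hj, plotDeriv_zero]
    · refine tendsto_of_forall_ge_tendsto_apply h (i₀ := i₀) fun j hj => ?_
      have hl' : (l : ℕ∞) ≤ k := le_trans (by exact_mod_cast l.le_succ) hl
      have hcons : (fun i : Fin (l + 1) => u i.rev) =
          Fin.cons (α := fun _ => E) (u (Fin.last l)) fun i => Fin.init u i.rev := by
        funext i
        refine Fin.cases ?_ (fun i => ?_) i
        · simp
        · simp [Fin.init, Fin.rev_succ]
      rw [hH (l + 1) x _ hl hx j hj, hcons]
      refine ((hg j hj).tendsto_slope_plotDeriv hN hl hx (fun i => Fin.init u i.rev)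
        (u (Fin.last l))).congr' ?_
      have hev : ∀ᶠ t : 𝕜 in 𝓝[≠] 0, x + t • u (Fin.last l) ∈ N :=
        (eventually_add_smul_mem hN hx _).filter_mono nhdsWithin_le_nhds
      filter_upwards [hev] with t ht
      rw [map_smul, map_sub, hH l _ _ hl' ht j hj, hH l x _ hl' hx j hj]
  -- `W` fixes `j`, and `j` fixes `q`; so the neighbourhood `{v | q v < 1}` is independent of `ε`,
  -- as `(π)` demands.
  · obtain ⟨j, hj, r, hr, hrW⟩ := exists_preimage_ball_subset h (i₀ := i₀) hW
    obtain ⟨q, hq, -, hqu⟩ := hu j hj x hx l hl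
    refine ⟨{v | q v < 1}, (isOpen_lt hq continuous_const).mem_nhds (by simp), fun ε hε => ?_⟩
    have hcont : Tendsto (fun v => x + v) (𝓝 0) (𝓝 x) := by
      simpa using (by fun_prop : Continuous fun v : E => x + v).tendsto 0
    have hev : ∀ᶠ v in 𝓝 (0 : E), x + v ∈ N ∧ ∀ u : Fin l → E, (∀ i, q (u i) ≤ 1) →
        normSeminorm 𝕜 (G j) (plotDeriv 𝕜 (fun x => p j (g x)) l (x + v) u -
          plotDeriv 𝕜 (fun x => p j (g x)) l x u) ≤ ε * r :=
      hcont.eventually ((hN.eventually_mem hx).and (hqu (ε * r) (by positivity)))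
    refine ⟨_, hev, fun v hv => ⟨hv.1, fun u hu' => ?_⟩⟩
    have hε' : (ε : 𝕜) ≠ 0 := by exact_mod_cast hε.ne'
    rw [Set.mem_smul_set_iff_inv_smul_mem₀ hε', hD _ hv.1, hD _ hx]
    refine hrW _ ?_
    rw [map_smul, map_sub, hH l _ _ hl hv.1 j hj, hH l x _ hl hx j hj, norm_smul, norm_inv,
      RCLike.norm_ofReal, abs_of_pos hε, inv_mul_le_iff₀ hε]
    exact hv.2 _ fun i => (hu' i.rev).le

end Assembly

/-! ### Lifting solutions between levels, and propagation along segments. -/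

section Levels

variable {𝕜 : Type*} [RCLike 𝕜]
  {E : Type*} [AddCommGroup E] [Module 𝕜 E] [TopologicalSpace E] [IsTopologicalAddGroup E]
  [ContinuousSMul 𝕜 E]
  {G₀ : Type*} [NormedAddCommGroup G₀] [NormedSpace 𝕜 G₀]
  {G₁ : Type*} [NormedAddCommGroup G₁] [NormedSpace 𝕜 G₁]
  {k : ℕ∞} {f₀ : E × G₀ →. G₀} {f₁ : E × G₁ →. G₁}
  {D₁ : ∀ l : ℕ, E × G₁ → ContinuousMultilinearMap 𝕜 (fun _ : Fin l => E × G₁) G₁}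
  {ρ : G₁ →L[𝕜] G₀} {b₁ : G₁}

/-- `Part.map` preserves domains, so a lower solution at a point that lifts is automatically in the
upper domain; injectivity then identifies the value. -/
theorem mem_iff_of_map_eq (hρ : Function.Injective ρ)
    (hf : ∀ (x : E) (y : G₁), (f₁ (x, y)).map ρ = f₀ (x, ρ y)) {x : E} {y : G₁} :
    b₁ ∈ f₁ (x, y) ↔ ρ b₁ ∈ f₀ (x, ρ y) := by
  rw [← hf, Part.mem_map_iff]
  constructor
  · exact fun h => ⟨b₁, h, rfl⟩
  · rintro ⟨c, hc, hcb⟩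
    rwa [← hρ hcb]

/-- A solution that lifts to `G₁` at `x` lifts continuously near `x`. -/
theorem exists_continuousAt_lift [CompleteSpace G₁] (h₁ : IsKellerJet k f₁ D₁) (hk : 1 ≤ k)
    (hρ : Function.Injective ρ) (hf : ∀ (x : E) (y : G₁), (f₁ (x, y)).map ρ = f₀ (x, ρ y))
    {N : Set E} (hN : IsOpen N) {y₀ : G₀} {r : ℝ} {g : E → G₀}
    (huniq : ∀ x ∈ N, ∀ y ∈ Metric.ball y₀ r, ρ b₁ ∈ f₀ (x, y) → y = g x)
    {x : E} (hx : x ∈ N) (hgx : g x ∈ Metric.ball y₀ r) (hb : ρ b₁ ∈ f₀ (x, g x)) {y : G₁}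
    (hy : ρ y = g x) (hbij : Function.Bijective (partialDeriv₂ D₁ (x, y))) :
    ∃ h : E → G₁, ContinuousAt h x ∧ ∀ᶠ x' in 𝓝 x, ρ (h x') = g x' := by
  have hby : b₁ ∈ f₁ (x, y) := (mem_iff_of_map_eq hρ hf).2 (by rwa [hy])
  obtain ⟨N', r', h, hN', hxN', -, hr', -, hh, huniq', hcont⟩ :=
    h₁.exists_implicit hk hby hbij (O := Set.univ) univ_mem
  have hhx : y = h x := huniq' x hxN' y (Metric.mem_ball_self hr') hby
  have hc : ContinuousAt h x := hcont.continuousAt (hN'.mem_nhds hxN')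
  have hcρ : ContinuousAt (fun x => ρ (h x)) x := ρ.continuous.continuousAt.comp hc
  -- Pushed down, the local upper solution stays in the ball where lower solutions are unique, so it
  -- must be `g`.
  have hball : ∀ᶠ x' in 𝓝 x, ρ (h x') ∈ Metric.ball y₀ r :=
    hcρ.eventually_mem (Metric.isOpen_ball.mem_nhds (by rwa [← hhx, hy]))
  refine ⟨h, hc, ?_⟩
  filter_upwards [hball, hN.mem_nhds hx, hN'.mem_nhds hxN'] with x' h1 h2 h3
  exact huniq x' h2 _ h1 ((mem_iff_of_map_eq hρ hf).1 (hh x' h3).2.1)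

end Levels

/-- A set of points of a star-shaped set `N` that is open in `N`, contains the centre, and is closed
under limits along the segments from the centre is all of `N`. -/
theorem forall_mem_of_segment {𝕜 : Type*} [RCLike 𝕜] {E : Type*} [AddCommGroup E] [Module 𝕜 E]
    [TopologicalSpace E] [IsTopologicalAddGroup E] [ContinuousSMul 𝕜 E] {N S : Set E} {x₀ : E}
    (hstar : ∀ x ∈ N, ∀ t : 𝕜, ‖t‖ ≤ 1 → (1 - t) • x₀ + t • x ∈ N) (hx₀ : x₀ ∈ S)
    (hopen : ∀ x ∈ N, x ∈ S → ∀ᶠ x' in 𝓝 x, x' ∈ S)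
    (hclosed : ∀ x ∈ N, (∀ n : ℕ, 1 ≤ n → (n : 𝕜)⁻¹ • x₀ + (1 - (n : 𝕜)⁻¹) • x ∈ S) → x ∈ S) :
    ∀ x ∈ N, x ∈ S := by
  intro x hx
  by_contra hxS
  let γ : ℝ → E := fun t => (1 - (t : 𝕜)) • x₀ + (t : 𝕜) • x
  have hγc : Continuous γ := by
    have : Continuous fun t : ℝ => (t : 𝕜) := RCLike.continuous_ofReal
    fun_prop
  have hγN : ∀ t ∈ Set.Icc (0 : ℝ) 1, γ t ∈ N := fun t ht =>
    hstar x hx t (by rw [RCLike.norm_ofReal, abs_of_nonneg ht.1]; exact ht.2)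
  set T : Set ℝ := {t | t ∈ Set.Icc (0 : ℝ) 1 ∧ γ t ∉ S} with hT
  have h1T : (1 : ℝ) ∈ T := ⟨by simp, by simpa [γ] using hxS⟩
  have hTb : BddBelow T := ⟨0, fun t ht => ht.1.1⟩
  set s := sInf T with hs
  have hs0 : 0 ≤ s := le_csInf ⟨1, h1T⟩ fun t ht => ht.1.1
  have hs1 : s ≤ 1 := csInf_le hTb h1T
  have hlt : ∀ t, 0 ≤ t → t < s → γ t ∈ S := by
    intro t ht hts
    by_contra hcon
    exact absurd (csInf_le hTb ⟨⟨ht, by linarith⟩, hcon⟩) (not_le.2 hts)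
  have hsN : γ s ∈ N := hγN s ⟨hs0, hs1⟩
  have hsS : γ s ∈ S := by
    rcases hs0.eq_or_lt with h0 | h0
    · rw [← h0]
      simpa [γ] using hx₀
    refine hclosed _ hsN fun n hn => ?_
    have hn' : (1 : ℝ) ≤ n := by exact_mod_cast hn
    have hn0 : (0 : ℝ) < (n : ℝ)⁻¹ := by positivity
    have hn1 : (n : ℝ)⁻¹ ≤ 1 := inv_le_one_of_one_le₀ hn'
    -- The points approaching `γ s` lie on the original segment at parameters strictly below `s`,
    -- where membership in `S` is known.
    have e : (n : 𝕜)⁻¹ • x₀ + (1 - (n : 𝕜)⁻¹) • γ s = γ ((1 - (n : ℝ)⁻¹) * s) := by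
      simp only [γ]
      push_cast
      module
    rw [e]
    exact hlt _ (mul_nonneg (by linarith) hs0) (by nlinarith)
  -- Openness carries membership beyond `s`, contradicting that `s` is the infimum of the bad
  -- parameters.
  have hev : ∀ᶠ t in 𝓝 s, γ t ∈ S := hγc.continuousAt.eventually (hopen _ hsN hsS)
  obtain ⟨δ, hδ, hball⟩ := Metric.eventually_nhds_iff.1 hev
  obtain ⟨t, ht, hts⟩ := exists_lt_of_csInf_lt ⟨1, h1T⟩ (show sInf T < s + δ by linarith)
  have hst : s ≤ t := csInf_le hTb ht
  refine ht.2 (hball ?_)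
  rw [Real.dist_eq, abs_of_nonneg (by linarith)]
  linarith

end KellerIFT

/-! ### The implicit function theorem in `F`. -/

theorem theorem4p5 {𝕜 : Type uK} [RCLike 𝕜]
    {E : Type uE} [AddCommGroup E] [Module 𝕜 E] [Module ℝ E] [IsScalarTower ℝ 𝕜 E]
    [TopologicalSpace E] [IsTopologicalAddGroup E] [ContinuousSMul 𝕜 E] [LocallyConvexSpace ℝ E]
    [T2Space E]
    {F : Type uF} [AddCommGroup F] [Module 𝕜 F] [Module ℝ F] [IsScalarTower ℝ 𝕜 F]
    [TopologicalSpace F] [IsTopologicalAddGroup F] [ContinuousSMul 𝕜 F] [LocallyConvexSpace ℝ F]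
    [T2Space F]
    (k : ℕ∞) (f : E × F →. F) (z : E × F) (b : F)
    (hf : KellerIFT.IsBd₂Extensible.{uK, uE, uF, uI, uG} 𝕜 k f z b) :
    ∃ W : Set (E × F), IsOpen W ∧ z ∈ W ∧
      KellerIFT.RelIsKellerC 𝕜 k (f.preimage {b} ∩ W) := by
  obtain ⟨ι, _, G, _, _, ρ, φ, p, ⟨hlim, hcomp, hext⟩, hk, hb, hφ, i₀, W₀, hW₀, hz₀, hW₀dom,
    ⟨ℓ₀, hℓ₀, hbij₀⟩, H⟩ := hf
  obtain ⟨x₀, y₀⟩ := z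
  dsimp only at hb hz₀ hℓ₀ H
  have hcompl := hcomp
  choose D hD using fun i => (hφ i).exists_jet
  have hp : ∀ (i j : ι) (hij : i ≤ j) (y : F), ρ i j hij (p j y) = p i y := fun i j hij y =>
    (DFunLike.congr_fun (hlim.2.2.1 i j hij) y).symm
  have hinj := fun j hj => (H j hj).1
  have hfj := fun j hj => (H j hj).2.1
  have hfρ := fun j hj => (H j hj).2.2.1
  have hb₀ : p i₀ b ∈ φ i₀ (x₀, p i₀ y₀) := hext i₀ x₀ y₀ b hb
  rw [(hD i₀).eq_partialDeriv₂ hk (hW₀dom hz₀) hℓ₀] at hbij₀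
  obtain ⟨N, r, g, hN, hx₀N, hstar, hr, hNO, hg, huniq, hgc⟩ :=
    (hD i₀).exists_implicit hk hb₀ hbij₀ (hW₀.mem_nhds hz₀)
  have hg₀ : p i₀ y₀ = g x₀ := huniq x₀ hx₀N _ (Metric.mem_ball_self hr) hb₀
  have hmem : ∀ (j : ι) (hj : i₀ ≤ j), ∀ x ∈ N, ∀ y : G j, ρ i₀ j hj y = g x →
      p j b ∈ φ j (x, y) := fun j hj x hx y hy =>
    (KellerIFT.mem_iff_of_map_eq (hinj j hj) (hfρ j hj)).2 (by
      rw [hp, hy]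
      exact (hg x hx).2.1)
  -- Condition (2) applies at every lift, because `N` and the ball were chosen so that the graph of
  -- `g` stays in `W₀`.
  have hbijj : ∀ (j : ι) (hj : i₀ ≤ j), ∀ x ∈ N, ∀ y : G j, ρ i₀ j hj y = g x →
      Function.Bijective (KellerIFT.partialDeriv₂ (D j) (x, y)) := by
    intro j hj x hx y hy
    refine (H j hj).2.2.2.1 x y _ ((hD j).isPartialDeriv₂ hk
      (Part.dom_iff_mem.2 ⟨_, hmem j hj x hx y hy⟩)) ?_ ?_
    · rw [hy]
      exact hNO x hx _ (hg x hx).1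
    · rw [hy]
      exact ⟨_, (hD i₀).isPartialDeriv₂ hk (Part.dom_iff_mem.2 ⟨_, (hg x hx).2.1⟩),
        (hg x hx).2.2⟩
  have hlift : ∀ (j : ι) (hj : i₀ ≤ j), ∀ x ∈ N, ∀ y : G j, ρ i₀ j hj y = g x →
      ∃ h : E → G j, ContinuousAt h x ∧ ∀ᶠ x' in 𝓝 x, ρ i₀ j hj (h x') = g x' := by
    intro j hj x hx y hy
    refine KellerIFT.exists_continuousAt_lift (b₁ := p j b) (hD j) hk (hinj j hj) (hfρ j hj) hN
      (y₀ := p i₀ y₀) (r := r) ?_ hx (hg x hx).1 ?_ hy (hbijj j hj x hx y hy)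
    · rw [hp]
      exact huniq
    · rw [hp]
      exact (hg x hx).2.1
  have hrange : ∀ (j : ι) (hj : i₀ ≤ j), ∀ x ∈ N, ∃ y : G j, ρ i₀ j hj y = g x := by
    intro j hj
    refine KellerIFT.forall_mem_of_segment (S := {x | ∃ y : G j, ρ i₀ j hj y = g x}) hstar
      ⟨p j y₀, by rw [hp, hg₀]⟩ ?_ ?_
    · rintro x hx ⟨y, hy⟩
      obtain ⟨h, -, hh⟩ := hlift j hj x hx y hy
      filter_upwards [hh] with x' hx' using ⟨h x', hx'⟩
    · intro x hx hseq
      have hseq' : ∀ n : ℕ, ∃ y : G j, 1 ≤ n →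
          ρ i₀ j hj y = g ((n : 𝕜)⁻¹ • x₀ + (1 - (n : 𝕜)⁻¹) • x) := by
        intro n
        by_cases hn : 1 ≤ n
        · obtain ⟨y, hy⟩ := hseq n hn
          exact ⟨y, fun _ => hy⟩
        · exact ⟨0, fun h => absurd h hn⟩
      choose y hy using hseq'
      have hxn : ∀ n : ℕ, 1 ≤ n → (n : 𝕜)⁻¹ • x₀ + (1 - (n : 𝕜)⁻¹) • x ∈ N := by
        intro n hn
        have hn' : (1 : ℝ) ≤ n := by exact_mod_cast hn
        have hn1 : (n : ℝ)⁻¹ ≤ 1 := inv_le_one_of_one_le₀ hn'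
        have hn0 : 0 ≤ (n : ℝ)⁻¹ := by positivity
        have := hstar x hx ((1 - (n : ℝ)⁻¹ : ℝ) : 𝕜) (by
          rw [RCLike.norm_ofReal, abs_of_nonneg (by linarith)]
          linarith)
        push_cast at this
        rwa [sub_sub_cancel] at this
      -- Condition (3): the lifts need not converge in `G j`, only their images in `G i₀`, which do
      -- so by continuity of `g`.
      refine (H j hj).2.2.2.2 x (g x) y (fun n hn => ?_) (hg x hx).2.1 ?_
      · rw [hy n hn]
        exact (hg _ (hxn n hn)).2.1
      · have hlim : Tendsto (fun n : ℕ => (n : 𝕜)⁻¹ • x₀ + (1 - (n : 𝕜)⁻¹) • x) atTop (𝓝 x) := by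
          have h0 : Tendsto (fun n : ℕ => (n : 𝕜)⁻¹) atTop (𝓝 0) :=
            tendsto_inv_atTop_nhds_zero_nat
          have := (h0.smul_const x₀).add ((h0.const_sub 1).smul_const x)
          simpa using this
        refine ((hgc.continuousAt (hN.mem_nhds hx)).tendsto.comp hlim).congr' ?_
        filter_upwards [eventually_ge_atTop 1] with n hn using (hy n hn).symm
  have hexj : ∀ (j : ι) (hj : i₀ ≤ j) (x : E), ∃ y : G j, x ∈ N → ρ i₀ j hj y = g x := by
    intro j hj x
    by_cases hx : x ∈ N
    · obtain ⟨y, hy⟩ := hrange j hj x hx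
      exact ⟨y, fun _ => hy⟩
    · exact ⟨0, fun h => absurd h hx⟩
  choose gj hgj using hexj
  have hex : ∀ x : E, ∃ y : F, x ∈ N → ∀ j hj, p j y = gj j hj x := by
    intro x
    by_cases hx : x ∈ N
    -- Compatibility can be tested after the injective map to `G i₀`, where all lifts become `g x`.
    · obtain ⟨y, hy⟩ := KellerIFT.exists_apply_eq_of_compatible hlim (fun j hj => gj j hj x)
        fun i j hi hij => hinj i hi (by rw [hlim.1.map_map, hgj j _ x hx, hgj i hi x hx])
      exact ⟨y, fun _ => hy⟩
    · exact ⟨0, fun h => absurd h hx⟩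
  choose gF hgF using hex
  have hρg : ∀ (j : ι) (hj : i₀ ≤ j), ∀ x ∈ N, ρ i₀ j hj (p j (gF x)) = g x := fun j hj x hx => by
    rw [hgF x hx j hj, hgj j hj x hx]
  have hgc' : ∀ (j : ι), i₀ ≤ j → ContinuousOn (fun x => p j (gF x)) N := by
    intro j hj x hx
    obtain ⟨h, hh, hev⟩ := hlift j hj x hx _ (hρg j hj x hx)
    refine (hh.congr ?_).continuousWithinAt
    filter_upwards [hev, hN.mem_nhds hx] with x' h1 h2
    exact hinj j hj (by rw [h1, hρg j hj x' h2])
  have hmem' : ∀ (j : ι), i₀ ≤ j → ∀ x ∈ N, p j b ∈ φ j (x, p j (gF x)) := fun j hj x hx =>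
    hmem j hj x hx _ (hρg j hj x hx)
  have hbij' : ∀ (j : ι), i₀ ≤ j → ∀ x ∈ N,
      Function.Bijective (KellerIFT.partialDeriv₂ (D j) (x, p j (gF x))) := fun j hj x hx =>
    hbijj j hj x hx _ (hρg j hj x hx)
  -- Only the `i₀`-component of `y` is confined: uniqueness in `G i₀` together with injectivity
  -- determines the whole point.
  refine ⟨{w | w.1 ∈ N ∧ p i₀ w.2 ∈ Metric.ball (p i₀ y₀) r}, ?_, ⟨hx₀N, Metric.mem_ball_self hr⟩,
    fun x => ⟨x ∈ N, fun _ => gF x⟩, ?_, ?_⟩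
  · exact (hN.preimage continuous_fst).inter
      (Metric.isOpen_ball.preimage ((p i₀).continuous.comp continuous_snd))
  · ext ⟨x, y⟩
    constructor
    · rintro ⟨hx, hxy⟩
      change x ∈ N at hx
      obtain rfl : gF x = y := hxy
      refine ⟨⟨b, rfl, ?_⟩, hx, ?_⟩
      · have h0 := hmem' i₀ le_rfl x hx
        -- Equality of domains at level `i₀` puts `(x, gF x)` in the domain of `f`; the value is
        -- then `b` because all its components above `i₀` agree with those of `b`.
        rw [← hfj i₀ le_rfl, Part.mem_map_iff] at h0
        obtain ⟨c, hc, -⟩ := h0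
        have hcb : c = b := KellerIFT.eq_of_forall_ge_apply_eq hlim (i₀ := i₀) fun j hj =>
          Part.mem_unique (hext j _ _ c hc) (hmem' j hj x hx)
        rwa [← hcb]
      · have := hρg i₀ le_rfl x hx
        rw [hp] at this
        change p i₀ (gF x) ∈ _
        rw [this]
        exact (hg x hx).1
    · rintro ⟨⟨b', rfl, hb'⟩, hx, hy⟩
      change x ∈ N at hx
      change p i₀ y ∈ _ at hy
      have hy' : p i₀ y = g x := huniq x hx _ hy (hext i₀ x y _ hb')
      refine ⟨hx, KellerIFT.eq_of_forall_ge_apply_eq hlim (i₀ := i₀) fun j hj => hinj j hj ?_⟩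
      rw [hρg j hj x hx, hp, hy']
  · refine KellerIFT.isKellerC_of_forall_component hlim (i₀ := i₀) hN (fun j hj => ?_)
      fun j hj x hx l hl => ?_
    · exact (hD j).plotContDiffOn_implicit hk hN (hgc' j hj) (hmem' j hj) (hbij' j hj)
    · exact (hD j).exists_seminorm_uniformAt_plotDeriv hk hN (hgc' j hj) (hmem' j hj) (hbij' j hj)
        hx hl
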